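/- Let $d\ge 2$ be a fixed integer, and let $B(x)\subset\mathbb{R}^d$, for $x\in\mathbb{R}^d$, denote one of the following: the open ball of radius $1$ centred at $x$, the closed ball of radius $1$ centred at $x$, the open axis-parallel cube of side length $1$ centred at $x$, or the closed axis-parallel cube of side length $1$ centred at $x$. There is an algorithm on a real RAM (exact arithmetic $+,-,\times,/$ and comparisons on real numbers and $+,-$ and comparisons on natural numbers at unit cost, unbounded indirectly addressed memory, no rounding) that, given $n\ge 0$ centres $c_1,\dots,c_n\in\mathbb{R}^d$ and an integer $k\ge 0$, decides in time $n^{O(k^{1-1/d})}$ whether there are $k$ pairwise nonintersecting ones among $B(c_1),\dots,B(c_n)$. Precisely, there are a program and a constant $C$, both depending only on $d$ and on which of the four bodies is considered, such that for all $n$, $k$ and $c_1,\dots,c_n$ the program halts with the correct answer after at most $C\cdot\max(n,1)^{C k^{1-1/d}}$ steps. -/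

import Mathlib

/-!
### The real random access machine

Programs of a real RAM, written as while-programs.  The memory consists of arrays of natural numbers
and arrays of real numbers, all unbounded and addressed indirectly: an index may be computed from
other cells.  An array is named by a numeral in the program text, so a program uses finitely many.
Natural numbers can be added, subtracted (truncated at `0`) and compared; real numbers can be added,
subtracted, multiplied, divided and compared exactly.  There is no rounding, and no way from real
numbers to natural numbers other than through comparisons.  Every operation, literal, memory access,
comparison and control step costs one unit of time.
-/

namespace RealRAM

/-- The memory: `nat a i` and `real a i` are the cells with index `i` of the arrays named `a`. -/
structure Memory where
  nat : ℕ → ℕ → ℕ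
  real : ℕ → ℕ → ℝ

/-- Expressions for natural numbers. -/
inductive NExpr where
  | lit (m : ℕ)
  | load (a : ℕ) (index : NExpr)
  | add (e f : NExpr)
  | sub (e f : NExpr)

/-- Expressions for real numbers; the only literals are rational. -/
inductive RExpr where
  | lit (q : ℚ)
  | load (a : ℕ) (index : NExpr)
  | add (e f : RExpr)
  | sub (e f : RExpr)
  | mul (e f : RExpr)
  | div (e f : RExpr)

/-- Tests. -/
inductive Test where
  | natLE (e f : NExpr)
  | natEq (e f : NExpr)
  | realLE (e f : RExpr)
  | realLT (e f : RExpr)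
  | not (b : Test)
  | and (b c : Test)

/-- Programs. -/
inductive Program where
  | skip
  | natStore (a : ℕ) (index : NExpr) (e : NExpr)
  | realStore (a : ℕ) (index : NExpr) (e : RExpr)
  | seq (p q : Program)
  | branch (b : Test) (p q : Program)
  | loop (b : Test) (p : Program)

namespace NExpr

def eval (s : Memory) : NExpr → ℕ
  | lit m => m
  | load a i => s.nat a (i.eval s)
  | add e f => e.eval s + f.eval s
  | sub e f => e.eval s - f.eval s

def cost : NExpr → ℕ
  | lit _ => 1
  | load _ i => i.cost + 1
  | add e f => e.cost + f.cost + 1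
  | sub e f => e.cost + f.cost + 1

end NExpr

namespace RExpr

noncomputable def eval (s : Memory) : RExpr → ℝ
  | lit q => (q : ℝ)
  | load a i => s.real a (i.eval s)
  | add e f => e.eval s + f.eval s
  | sub e f => e.eval s - f.eval s
  | mul e f => e.eval s * f.eval s
  | div e f => e.eval s / f.eval s

def cost : RExpr → ℕ
  | lit _ => 1
  | load _ i => i.cost + 1
  | add e f => e.cost + f.cost + 1
  | sub e f => e.cost + f.cost + 1
  | mul e f => e.cost + f.cost + 1
  | div e f => e.cost + f.cost + 1

end RExpr

namespace Test

def Holds (s : Memory) : Test → Prop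
  | natLE e f => e.eval s ≤ f.eval s
  | natEq e f => e.eval s = f.eval s
  | realLE e f => e.eval s ≤ f.eval s
  | realLT e f => e.eval s < f.eval s
  | not b => ¬ b.Holds s
  | and b c => b.Holds s ∧ c.Holds s

def cost : Test → ℕ
  | natLE e f => e.cost + f.cost + 1
  | natEq e f => e.cost + f.cost + 1
  | realLE e f => e.cost + f.cost + 1
  | realLT e f => e.cost + f.cost + 1
  | not b => b.cost + 1
  | and b c => b.cost + c.cost + 1

end Test

/-- The memory `s` after `v` has been written into cell `i` of the natural number array `a`. -/
def Memory.setNat (s : Memory) (a i v : ℕ) : Memory :=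
  { s with nat := Function.update s.nat a (Function.update (s.nat a) i v) }

/-- The memory `s` after `v` has been written into cell `i` of the real array `a`. -/
def Memory.setReal (s : Memory) (a i : ℕ) (v : ℝ) : Memory :=
  { s with real := Function.update s.real a (Function.update (s.real a) i v) }

/-- `Runs p s s' t`: started in memory `s`, the program `p` halts in memory `s'` after time `t`. -/
inductive Runs : Program → Memory → Memory → ℕ → Prop where
  | skip (s : Memory) : Runs .skip s s 1
  | natStore (s : Memory) (a : ℕ) (i e : NExpr) :
      Runs (.natStore a i e) s (s.setNat a (i.eval s) (e.eval s)) (i.cost + e.cost + 1)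
  | realStore (s : Memory) (a : ℕ) (i : NExpr) (e : RExpr) :
      Runs (.realStore a i e) s (s.setReal a (i.eval s) (e.eval s)) (i.cost + e.cost + 1)
  | seq {p q : Program} {s s' s'' : Memory} {t t' : ℕ} :
      Runs p s s' t → Runs q s' s'' t' → Runs (.seq p q) s s'' (t + t')
  | branchTrue {b : Test} {p q : Program} {s s' : Memory} {t : ℕ} :
      b.Holds s → Runs p s s' t → Runs (.branch b p q) s s' (b.cost + t + 1)
  | branchFalse {b : Test} {p q : Program} {s s' : Memory} {t : ℕ} :
      ¬ b.Holds s → Runs q s s' t → Runs (.branch b p q) s s' (b.cost + t + 1)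
  | loopDone {b : Test} {p : Program} {s : Memory} :
      ¬ b.Holds s → Runs (.loop b p) s s (b.cost + 1)
  | loopStep {b : Test} {p : Program} {s s' s'' : Memory} {t t' : ℕ} :
      b.Holds s → Runs p s s' t → Runs (.loop b p) s' s'' t' →
        Runs (.loop b p) s s'' (b.cost + t + t' + 1)

/-- The machine is deterministic: result and running time are determined by program and input. -/
theorem Runs.unique {p : Program} {s s₁ s₂ : Memory} {t₁ t₂ : ℕ}
    (h₁ : Runs p s s₁ t₁) (h₂ : Runs p s s₂ t₂) : s₁ = s₂ ∧ t₁ = t₂ := by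
  induction h₁ generalizing s₂ t₂ with
  | skip s => cases h₂; exact ⟨rfl, rfl⟩
  | natStore s a i e => cases h₂; exact ⟨rfl, rfl⟩
  | realStore s a i e => cases h₂; exact ⟨rfl, rfl⟩
  | seq _ _ ih ih' =>
    cases h₂ with
    | seq g g' =>
      obtain ⟨rfl, rfl⟩ := ih g
      obtain ⟨rfl, rfl⟩ := ih' g'
      exact ⟨rfl, rfl⟩
  | branchTrue hb _ ih =>
    cases h₂ with
    | branchTrue _ g => obtain ⟨rfl, rfl⟩ := ih g; exact ⟨rfl, rfl⟩
    | branchFalse hb' _ => exact absurd hb hb'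
  | branchFalse hb _ ih =>
    cases h₂ with
    | branchTrue hb' _ => exact absurd hb' hb
    | branchFalse _ g => obtain ⟨rfl, rfl⟩ := ih g; exact ⟨rfl, rfl⟩
  | loopDone hb =>
    cases h₂ with
    | loopDone _ => exact ⟨rfl, rfl⟩
    | loopStep hb' _ _ => exact absurd hb' hb
  | loopStep hb _ _ ih ih' =>
    cases h₂ with
    | loopDone hb' => exact absurd hb hb'
    | loopStep _ g g' =>
      obtain ⟨rfl, rfl⟩ := ih g
      obtain ⟨rfl, rfl⟩ := ih' g'
      exact ⟨rfl, rfl⟩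

end RealRAM

/-! ### Packing -/

namespace Packing

/-- The open axis-parallel cube of side length `1` centred at `x`. -/
def openCube {d : ℕ} (x : EuclideanSpace ℝ (Fin d)) : Set (EuclideanSpace ℝ (Fin d)) :=
  {y | ∀ j, |y j - x j| < 1 / 2}

/-- The closed axis-parallel cube of side length `1` centred at `x`. -/
def closedCube {d : ℕ} (x : EuclideanSpace ℝ (Fin d)) : Set (EuclideanSpace ℝ (Fin d)) :=
  {y | ∀ j, |y j - x j| ≤ 1 / 2}

/-- Among the bodies `B (c 0), …, B (c (n - 1))` there are `k` pairwise nonintersecting ones. -/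
def HasPacking {d n : ℕ} (B : EuclideanSpace ℝ (Fin d) → Set (EuclideanSpace ℝ (Fin d)))
    (c : Fin n → EuclideanSpace ℝ (Fin d)) (k : ℕ) : Prop :=
  ∃ S : Finset (Fin n), S.card = k ∧ (S : Set (Fin n)).PairwiseDisjoint (fun i => B (c i))

/-- The initial memory: cells `0` and `1` of the natural number array `0` hold `n` and `k`, cell `i`
of the real array `j` holds the `j`-th coordinate of the `i`-th centre, all else is `0`. -/
noncomputable def input {d n : ℕ} (c : Fin n → EuclideanSpace ℝ (Fin d)) (k : ℕ) :
    RealRAM.Memory where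
  nat a i := if a = 0 ∧ i = 0 then n else if a = 0 ∧ i = 1 then k else 0
  real j i := if h : j < d ∧ i < n then c ⟨i, h.2⟩ ⟨j, h.1⟩ else 0

/-- The output of a halting computation: cell `0` of the natural number array `0`. -/
def output (s : RealRAM.Memory) : ℕ := s.nat 0 0

end Packing

/-!
A packing of `k` bodies can be cut by an axis-parallel hyperplane, properly and with only
`O(k ^ (1 - 1 / d))` centres near the hyperplane: if the centres extend over more than
`5 * k ^ (1 / d)` in some direction, then one of `k ^ (1 / d)` parallel strips is sparse, and
otherwise a slab has no room for more centres.  Repeated cutting yields boxes in which only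
`O(k ^ (1 - 1 / d))` centres of the packing are near the boundary.  Centres in conflict on the two
sides of a cut are both near it, so two packings in adjacent boxes can be united as soon as their
centres near the boundary are known.

The algorithm therefore derives facts which say that there is a packing of `m` centres in the box
`B` whose members near the boundary of `B` are among the points of the list `l`.  A box is given by
`2 * d` faces, each a coordinate of a centre shifted by `0`, `3` or `-3`, and lists have length
`O(k ^ (1 - 1 / d))`, so there are only `n ^ O(k ^ (1 - 1 / d))` facts.  They are numbered by
reading numbers as lists of digits in base `n + 3`.  In each of `k` rounds the algorithm marks the
facts about single centres and those that follow from two marked ones; whether a fact follows is a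
formula with bounded quantifiers over numbers, evaluated by nested loops.
-/

/- The preparation of the tables and the marking of facts both use the variables `5`, `6` and `7`,
at different times.  Those from `leftVar` to `otherVar` are bound by quantifiers, so their numbers
are levels of formulas. -/
local notation "inputArray" => 0
local notation "resultReg" => 1
local notation "headArray" => 2
local notation "tailArray" => 3
local notation "markArray" => 4
local notation "boundVar" => 5
local notation "roundVar" => 6
local notation "factVar" => 7
local notation "leftVar" => 8
local notation "rightVar" => 9
local notation "pointVar" => 10
local notation "otherVar" => 11
local notation "counterVar" => 5
local notation "quotientVar" => 6
local notation "remainderVar" => 7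
local notation "countReg" d:max => d + 1
local notation "baseReg" d:max => d + 2
local notation "lengthReg" d:max => d + 3
local notation "numberReg" d:max => d + 4
local notation "filledReg" d:max => d + 5

/-! ### Time-bounded total correctness -/

namespace RealRAM

section Memory

variable (s : Memory)

theorem Memory.setNat_nat (a i v b j : ℕ) :
    (s.setNat a i v).nat b j = if b = a ∧ j = i then v else s.nat b j := by
  by_cases hb : b = a
  · subst hb; by_cases hj : j = i <;> simp [Memory.setNat, hj]
  · simp [Memory.setNat, hb]

theorem Memory.setNat_nat_self (a i v : ℕ) : (s.setNat a i v).nat a i = v := by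
  simp [Memory.setNat_nat]

theorem Memory.setNat_nat_of_ne {a b : ℕ} (i v : ℕ) (h : b ≠ a) :
    (s.setNat a i v).nat b = s.nat b := by simp [Memory.setNat, h]

@[simp] theorem Memory.setNat_real (a i v : ℕ) : (s.setNat a i v).real = s.real := rfl

@[simp] theorem Memory.setReal_nat (a i : ℕ) (v : ℝ) : (s.setReal a i v).nat = s.nat := rfl

theorem Memory.setReal_real (a i : ℕ) (v : ℝ) (b j : ℕ) :
    (s.setReal a i v).real b j = if b = a ∧ j = i then v else s.real b j := by
  by_cases hb : b = a
  · subst hb; by_cases hj : j = i <;> simp [Memory.setReal, hj]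
  · simp [Memory.setReal, hb]

end Memory

/-- A Hoare triple for total correctness with a time bound: started in `s`, the program `p` halts
after at most `T` steps in a memory satisfying `Q`. -/
def HaltsWithin (p : Program) (s : Memory) (T : ℕ) (Q : Memory → Prop) : Prop :=
  ∃ s' t, Runs p s s' t ∧ t ≤ T ∧ Q s'

namespace HaltsWithin

variable {p q : Program} {b : Test} {s : Memory} {T T' : ℕ} {Q Q' : Memory → Prop}

theorem mono (h : HaltsWithin p s T Q) (hT : T ≤ T') (hQ : ∀ s', Q s' → Q' s') :
    HaltsWithin p s T' Q' := by
  obtain ⟨s', t, hrun, ht, hs'⟩ := h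
  exact ⟨s', t, hrun, ht.trans hT, hQ s' hs'⟩

theorem skip (h : Q s) : HaltsWithin .skip s 1 Q :=
  ⟨s, 1, .skip s, le_rfl, h⟩

theorem natStore {a : ℕ} {i e : NExpr} (h : Q (s.setNat a (i.eval s) (e.eval s))) :
    HaltsWithin (.natStore a i e) s (i.cost + e.cost + 1) Q :=
  ⟨_, _, .natStore s a i e, le_rfl, h⟩

theorem realStore {a : ℕ} {i : NExpr} {e : RExpr}
    (h : Q (s.setReal a (i.eval s) (e.eval s))) :
    HaltsWithin (.realStore a i e) s (i.cost + e.cost + 1) Q :=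
  ⟨_, _, .realStore s a i e, le_rfl, h⟩

theorem seq (hp : HaltsWithin p s T Q) (hq : ∀ s', Q s' → HaltsWithin q s' T' Q') :
    HaltsWithin (.seq p q) s (T + T') Q' := by
  obtain ⟨s', t, hrun, ht, hs'⟩ := hp
  obtain ⟨s'', t', hrun', ht', hs''⟩ := hq s' hs'
  exact ⟨s'', _, hrun.seq hrun', Nat.add_le_add ht ht', hs''⟩

theorem branch (hp : b.Holds s → HaltsWithin p s T Q) (hq : ¬ b.Holds s → HaltsWithin q s T Q) :
    HaltsWithin (.branch b p q) s (b.cost + T + 1) Q := by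
  by_cases hb : b.Holds s
  · obtain ⟨s', t, hrun, ht, hs'⟩ := hp hb
    exact ⟨s', _, hrun.branchTrue hb, by omega, hs'⟩
  · obtain ⟨s', t, hrun, ht, hs'⟩ := hq hb
    exact ⟨s', _, hrun.branchFalse hb, by omega, hs'⟩

/-- The loop rule with an invariant `I m`, where the variant `m` bounds the number of rounds that
are still to come. -/
theorem loop {I : ℕ → Memory → Prop} (hdone : ∀ m s, I m s → ¬ b.Holds s → Q s)
    (hstep : ∀ m s, I m s → b.Holds s → HaltsWithin p s T fun s' => ∃ m' < m, I m' s')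
    {m : ℕ} {s : Memory} (h : I m s) :
    HaltsWithin (.loop b p) s (m * (T + b.cost + 1) + (b.cost + 1)) Q := by
  induction m using Nat.strong_induction_on generalizing s with
  | _ m ih =>
  by_cases hb : b.Holds s
  · obtain ⟨s', t, hrun, ht, m', hm', hs'⟩ := hstep m s h hb
    obtain ⟨s'', t', hrun', ht', hs''⟩ := ih m' hm' hs'
    refine ⟨s'', _, .loopStep hb hrun hrun', ?_, hs''⟩
    have := Nat.mul_le_mul_right (T + b.cost + 1) (Nat.succ_le_of_lt hm')
    rw [Nat.succ_mul] at this
    omega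
  · exact ⟨s, _, .loopDone hb, Nat.le_add_left _ _, hdone m s h hb⟩

theorem seq_of_eq {s' : Memory} (hp : HaltsWithin p s T (· = s')) (hq : HaltsWithin q s' T' Q) :
    HaltsWithin (.seq p q) s (T + T') Q :=
  hp.seq fun _ h => h ▸ hq

theorem loop_of_eq {mem : ℕ → Memory} {m V : ℕ} (hm : m ≤ V)
    (hguard : ∀ i, b.Holds (mem i) ↔ i < m)
    (hstep : ∀ i, HaltsWithin p (mem i) T (· = mem (i + 1))) :
    HaltsWithin (.loop b p) (mem 0) (V * (T + b.cost + 1) + (b.cost + 1)) (· = mem m) := by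
  refine (HaltsWithin.loop (I := fun r s => r ≤ m ∧ s = mem (m - r)) (m := m) ?_ ?_
    ⟨le_rfl, by rw [Nat.sub_self]⟩).mono (by gcongr) fun _ h => h
  · rintro r _ ⟨hr, rfl⟩ hb
    rw [hguard] at hb
    rw [show r = 0 by omega, Nat.sub_zero]
  · rintro r _ ⟨hr, rfl⟩ hb
    rw [hguard] at hb
    refine (hstep _).mono le_rfl fun s' hs' => ⟨r - 1, by omega, by omega, ?_⟩
    rw [hs', show m - r + 1 = m - (r - 1) by omega]

end HaltsWithin

/-- `f` is bounded by a polynomial.  Closure under sums and products is all that is used of this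
when running times are estimated. -/
def PolyBounded (f : ℕ → ℕ) : Prop := ∃ A m : ℕ, ∀ V, f V ≤ A * (V + 1) ^ m

namespace PolyBounded

variable {f g : ℕ → ℕ}

theorem const (A : ℕ) : PolyBounded fun _ => A := ⟨A, 0, fun V => by simp⟩

theorem id : PolyBounded fun V => V := ⟨1, 1, fun V => by simp⟩

theorem add (hf : PolyBounded f) (hg : PolyBounded g) : PolyBounded fun V => f V + g V := by
  obtain ⟨A, m, hA⟩ := hf
  obtain ⟨A', m', hA'⟩ := hg
  refine ⟨A + A', m + m', fun V => ?_⟩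
  calc f V + g V ≤ A * (V + 1) ^ m + A' * (V + 1) ^ m' := add_le_add (hA V) (hA' V)
    _ ≤ A * (V + 1) ^ (m + m') + A' * (V + 1) ^ (m + m') := by gcongr <;> omega
    _ = (A + A') * (V + 1) ^ (m + m') := by ring

theorem mul (hf : PolyBounded f) (hg : PolyBounded g) : PolyBounded fun V => f V * g V := by
  obtain ⟨A, m, hA⟩ := hf
  obtain ⟨A', m', hA'⟩ := hg
  refine ⟨A * A', m + m', fun V => ?_⟩
  calc f V * g V ≤ A * (V + 1) ^ m * (A' * (V + 1) ^ m') := Nat.mul_le_mul (hA V) (hA' V)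
    _ = A * A' * (V + 1) ^ (m + m') := by ring

theorem loop (hf : PolyBounded f) (b : Test) :
    PolyBounded fun V => V * (f V + b.cost + 1) + (b.cost + 1) :=
  (id.mul ((hf.add (const _)).add (const _))).add (const _)

end PolyBounded

/-! ### Bounded formulas and their evaluation on the machine -/

/-- The scalar variable `a`, which lives in cell `0` of the natural number array `a`. -/
abbrev NExpr.var (a : ℕ) : NExpr := .load a (.lit 0)

/-- All natural number arrays read by the expression are below `D` and none is the result register,
so that the value survives the evaluation of a formula at level `D`. -/
def NExpr.Below (D : ℕ) : NExpr → Prop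
  | lit _ => True
  | load a i => a < D ∧ a ≠ resultReg ∧ i.Below D
  | add e f => e.Below D ∧ f.Below D
  | sub e f => e.Below D ∧ f.Below D

/-- The counterpart of `NExpr.Below` for real expressions; the real arrays read are arbitrary. -/
def RExpr.Below (D : ℕ) : RExpr → Prop
  | lit _ => True
  | load _ i => i.Below D
  | add e f => e.Below D ∧ f.Below D
  | sub e f => e.Below D ∧ f.Below D
  | mul e f => e.Below D ∧ f.Below D
  | div e f => e.Below D ∧ f.Below D

/-- The counterpart of `NExpr.Below` for tests. -/
def Test.Below (D : ℕ) : Test → Prop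
  | natLE e f => e.Below D ∧ f.Below D
  | natEq e f => e.Below D ∧ f.Below D
  | realLE e f => e.Below D ∧ f.Below D
  | realLT e f => e.Below D ∧ f.Below D
  | not b => b.Below D
  | and b c => b.Below D ∧ c.Below D

/-- The memories agree except for the result register and the scalar variables from `D` on, the
only cells that the evaluation of a formula at level `D` overwrites. -/
structure Agree (D : ℕ) (s s' : Memory) : Prop where
  real : s'.real = s.real
  cell : ∀ a i, a ≠ resultReg → (a < D ∨ i ≠ 0) → s'.nat a i = s.nat a i

section Agree

variable {D : ℕ} {s s' : Memory}

theorem Agree.refl (D : ℕ) (s : Memory) : Agree D s s := ⟨rfl, fun _ _ _ _ => rfl⟩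

theorem Agree.nat (h : Agree D s s') {a : ℕ} (ha : a < D) (hres : a ≠ resultReg) :
    s'.nat a = s.nat a :=
  funext fun i => h.cell a i hres (.inl ha)

theorem Agree.setResult (h : Agree D s s') (v : ℕ) : Agree D s (s'.setNat resultReg 0 v) :=
  ⟨h.real, fun a i ha hi => by
    rw [Memory.setNat_nat, if_neg (by omega)]; exact h.cell a i ha hi⟩

theorem Agree.of_setNat {v : ℕ} (h : Agree (D + 1) (s.setNat D 0 v) s') : Agree D s s' :=
  ⟨h.real, fun a i ha hi => by
    rw [h.cell a i ha (by omega), Memory.setNat_nat, if_neg (by omega)]⟩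

theorem Agree.setNat (h : Agree D s s') (v : ℕ) :
    Agree (D + 1) (s.setNat D 0 v) (s'.setNat D 0 v) := by
  refine ⟨h.real, fun a i ha hi => ?_⟩
  rw [Memory.setNat_nat, Memory.setNat_nat]
  split_ifs with hcell
  · rfl
  · exact h.cell a i ha (by omega)

theorem Agree.bound_var {v : ℕ} (h : Agree (D + 1) (s.setNat D 0 v) s') (hres : D ≠ resultReg) :
    s'.nat D 0 = v := by
  rw [h.nat (Nat.lt_succ_self D) hres, Memory.setNat_nat_self]

theorem NExpr.eval_congr (h : Agree D s s') : ∀ e : NExpr, e.Below D → e.eval s' = e.eval s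
  | lit _, _ => rfl
  | load a i, hb => by simp only [eval, h.nat hb.1 hb.2.1, NExpr.eval_congr h i hb.2.2]
  | add e f, hb | sub e f, hb => by
    simp only [eval, NExpr.eval_congr h e hb.1, NExpr.eval_congr h f hb.2]

theorem RExpr.eval_congr (h : Agree D s s') : ∀ e : RExpr, e.Below D → e.eval s' = e.eval s
  | lit _, _ => rfl
  | load a i, hb => by simp only [eval, h.real, NExpr.eval_congr h i hb]
  | add e f, hb | sub e f, hb | mul e f, hb | div e f, hb => by
    simp only [eval, RExpr.eval_congr h e hb.1, RExpr.eval_congr h f hb.2]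

theorem Test.holds_congr (h : Agree D s s') : ∀ b : Test, b.Below D → (b.Holds s' ↔ b.Holds s)
  | natLE e f, hb | natEq e f, hb => by
    simp only [Holds, NExpr.eval_congr h e hb.1, NExpr.eval_congr h f hb.2]
  | realLE e f, hb | realLT e f, hb => by
    simp only [Holds, RExpr.eval_congr h e hb.1, RExpr.eval_congr h f hb.2]
  | not b, hb => by simp only [Holds, Test.holds_congr h b hb]
  | and b c, hb => by simp only [Holds, Test.holds_congr h b hb.1, Test.holds_congr h c hb.2]

end Agree

/-- `Visits next v w`: the nonzero number `w` occurs among `v, next v, next (next v), …` before the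
first `0`. -/
inductive Visits (next : ℕ → ℕ) : ℕ → ℕ → Prop
  | here {v : ℕ} : v ≠ 0 → Visits next v v
  | next {v w : ℕ} : v ≠ 0 → Visits next (next v) w → Visits next v w

namespace Visits

variable {next : ℕ → ℕ} {v w : ℕ}

theorem not_zero : ¬ Visits next 0 w := by
  intro h
  cases h with
  | here h => exact h rfl
  | next h _ => exact h rfl

theorem iff_of_ne_zero (hv : v ≠ 0) : Visits next v w ↔ w = v ∨ Visits next (next v) w := by
  constructor
  · intro h
    cases h with
    | here _ => exact .inl rfl
    | next _ h => exact .inr h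
  · rintro (rfl | h)
    · exact .here hv
    · exact .next hv h

theorem pred_iff : Visits (fun i => i - 1) v w ↔ 1 ≤ w ∧ w ≤ v := by
  induction v with
  | zero => exact ⟨fun h => absurd h not_zero, by omega⟩
  | succ v ih => simp only [iff_of_ne_zero v.succ_ne_zero, Nat.succ_sub_one, ih]; omega

end Visits

/-- How a bounded quantifier moves from one value to the next: down to `1` in steps of one, or along
the links in `tailArray`. -/
inductive Traversal where
  | countdown
  | links

namespace Traversal

/-- The value after `v`; the traversal ends at `0`. -/
def next (s : Memory) (v : ℕ) : Traversal → ℕ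
  | countdown => v - 1
  | links => s.nat tailArray v

/-- The expression that computes `Traversal.next` for the value of the variable `D`. -/
def nextExpr (D : ℕ) : Traversal → NExpr
  | countdown => .sub (.var D) (.lit 1)
  | links => .load tailArray (.var D)

theorem next_lt {s : Memory} (hlinks : ∀ v ≠ 0, s.nat tailArray v < v) {v : ℕ} (hv : v ≠ 0) :
    ∀ τ : Traversal, τ.next s v < v
  | countdown => Nat.sub_one_lt hv
  | links => hlinks v hv

theorem nextExpr_eval {D v : ℕ} {s₀ s : Memory} (hD : 4 ≤ D)
    (h : Agree (D + 1) (s₀.setNat D 0 v) s) (τ : Traversal) :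
    (τ.nextExpr D).eval s = τ.next s₀ v := by
  have hvar : s.nat D 0 = v := h.bound_var (by omega)
  have hlinks : s.nat tailArray = s₀.nat tailArray := h.of_setNat.nat (by omega) (by omega)
  cases τ <;> simp [nextExpr, next, NExpr.eval, hvar, hlinks]

theorem nextExpr_cost_le (D : ℕ) (τ : Traversal) : (τ.nextExpr D).cost ≤ 4 := by
  cases τ <;> simp [nextExpr, NExpr.cost]

end Traversal

/-- Bounded formulas over tests.  Bound variables are named by level: a quantifier at level `D`
binds the scalar variable `D`. -/
inductive Formula where
  | test (b : Test)
  | not (φ : Formula)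
  | and (φ ψ : Formula)
  | all (τ : Traversal) (start : NExpr) (φ : Formula)

/-- The result register holds the truth value of `P`. -/
def Memory.Reports (s : Memory) (P : Prop) : Prop :=
  (P → s.nat resultReg 0 = 1) ∧ (¬ P → s.nat resultReg 0 = 0)

theorem Memory.Reports.iff {s : Memory} {P : Prop} (h : s.Reports P) :
    s.nat resultReg 0 = 1 ↔ P := by
  by_cases hP : P
  · simp [hP, h.1 hP]
  · simp [hP, h.2 hP]

namespace Formula

/-- The truth of a formula at level `D`. -/
def Holds (D : ℕ) (s : Memory) : Formula → Prop
  | test b => b.Holds s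
  | not φ => ¬ φ.Holds D s
  | and φ ψ => φ.Holds D s ∧ ψ.Holds D s
  | all τ e φ => ∀ w, Visits (τ.next s) (e.eval s) w → φ.Holds (D + 1) (s.setNat D 0 w)

/-- The formula is well-scoped at level `D`. -/
def Below (D : ℕ) : Formula → Prop
  | test b => b.Below D
  | not φ => φ.Below D
  | and φ ψ => φ.Below D ∧ ψ.Below D
  | all _ e φ => e.Below D ∧ φ.Below (D + 1)

/-- All quantifiers start at numbers up to `V`. -/
def Bounded (V D : ℕ) (s : Memory) : Formula → Prop
  | test _ => True
  | not φ => φ.Bounded V D s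
  | and φ ψ => φ.Bounded V D s ∧ ψ.Bounded V D s
  | all _ e φ => e.eval s ≤ V ∧ ∀ w ≤ V, φ.Bounded V (D + 1) (s.setNat D 0 w)

/-- The guard of the loop that evaluates a quantifier at level `D`. -/
def quantifierGuard (D : ℕ) : Test :=
  .and (.not (.natEq (.var D) (.lit 0))) (.natEq (.var resultReg) (.lit 1))

/-- The program that evaluates a formula at level `D` into the result register. -/
def compile (D : ℕ) : Formula → Program
  | test b =>
    .branch b (.natStore resultReg (.lit 0) (.lit 1)) (.natStore resultReg (.lit 0) (.lit 0))
  | not φ => .seq (φ.compile D) (.natStore resultReg (.lit 0) (.sub (.lit 1) (.var resultReg)))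
  | and φ ψ =>
    .seq (φ.compile D) (.branch (.natEq (.var resultReg) (.lit 1)) (ψ.compile D) .skip)
  | all τ e φ =>
    .seq (.natStore D (.lit 0) e) <| .seq (.natStore resultReg (.lit 0) (.lit 1)) <|
      .loop (quantifierGuard D)
        (.seq (φ.compile (D + 1)) (.natStore D (.lit 0) (τ.nextExpr D)))

/-- A bound for the running time of `compile`, provided that all quantifiers start at numbers up to
`V`. -/
def costBound (V : ℕ) : Formula → ℕ
  | test b => b.cost + 4
  | not φ => φ.costBound V + 6
  | and φ ψ => φ.costBound V + ψ.costBound V + 6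
  | all _ e φ => e.cost + 16 + V * (φ.costBound V + 17)

theorem polyBounded_costBound : ∀ φ : Formula, PolyBounded φ.costBound
  | test _ => .const _
  | not φ => φ.polyBounded_costBound.add (.const 6)
  | and φ ψ => (φ.polyBounded_costBound.add ψ.polyBounded_costBound).add (.const 6)
  | all _ _ φ => (PolyBounded.const _).add (.mul .id (φ.polyBounded_costBound.add (.const 17)))

section Correctness

variable {V D : ℕ} {s₀ s : Memory}

/-- `p` evaluates the formula `φ` at level `D` within time `T`, in every memory that agrees with
`s₀`. -/
def EvaluatedBy (φ : Formula) (D : ℕ) (s₀ : Memory) (T : ℕ) (p : Program) : Prop :=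
  ∀ s, Agree D s₀ s → HaltsWithin p s T fun s' => Agree D s₀ s' ∧ s'.Reports (φ.Holds D s₀)

/-- The invariant of a quantifier loop that has reached the value `v`: so far no counterexample has
been met, or else the result register is `0`. -/
structure LoopInv (φ : Formula) (τ : Traversal) (V D start : ℕ) (s₀ : Memory) (v : ℕ)
    (s : Memory) : Prop where
  le : v ≤ V
  agree : Agree (D + 1) (s₀.setNat D 0 v) s
  bool : s.nat resultReg 0 = 0 ∨ s.nat resultReg 0 = 1
  holds_iff : (∀ w, Visits (τ.next s₀) start w → φ.Holds (D + 1) (s₀.setNat D 0 w)) ↔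
    s.nat resultReg 0 = 1 ∧
      ∀ w, Visits (τ.next s₀) v w → φ.Holds (D + 1) (s₀.setNat D 0 w)

theorem quantifierGuard_holds {v : ℕ} (hD : 4 ≤ D) (h : Agree (D + 1) (s₀.setNat D 0 v) s) :
    (quantifierGuard D).Holds s ↔ v ≠ 0 ∧ s.nat resultReg 0 = 1 := by
  simp [quantifierGuard, Test.Holds, NExpr.eval, h.bound_var (by omega : D ≠ resultReg)]

variable {φ ψ : Formula} {τ : Traversal} {T T' : ℕ} {p q : Program}

theorem evaluatedBy_test {b : Test} (hb : b.Below D) :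
    (test b).EvaluatedBy D s₀ (b.cost + 4) ((test b).compile D) := by
  intro s hs
  refine .branch (fun h => .natStore ⟨hs.setResult _, ?_⟩) (fun h => .natStore ⟨hs.setResult _, ?_⟩)
  all_goals
    rw [Test.holds_congr hs b hb] at h
    simp [Memory.Reports, Holds, h, Memory.setNat_nat_self, NExpr.eval]

theorem EvaluatedBy.not (hφ : φ.EvaluatedBy D s₀ T p) :
    φ.not.EvaluatedBy D s₀ (T + 6)
      (.seq p (.natStore resultReg (.lit 0) (.sub (.lit 1) (.var resultReg)))) := by
  intro s hs
  refine .seq (hφ s hs) fun s' ⟨hs', hrep⟩ => .natStore ⟨hs'.setResult _, fun h => ?_, fun h => ?_⟩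
  · simp [NExpr.eval, Memory.setNat_nat_self, hrep.2 h]
  · simp [NExpr.eval, Memory.setNat_nat_self, hrep.1 (not_not.1 h)]

theorem EvaluatedBy.and (hφ : φ.EvaluatedBy D s₀ T p) (hψ : ψ.EvaluatedBy D s₀ T' q) :
    (φ.and ψ).EvaluatedBy D s₀ (T + T' + 6)
      (.seq p (.branch (.natEq (.var resultReg) (.lit 1)) q .skip)) := by
  intro s hs
  refine (HaltsWithin.seq (T' := T' + 6) (hφ s hs) fun s' ⟨hs', hrep⟩ => ?_).mono
    (by omega) fun _ h => h
  have hguard : (Test.natEq (.var resultReg) (.lit 1)).Holds s' ↔ φ.Holds D s₀ := hrep.iff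
  refine (HaltsWithin.branch (T := T' + 1) (fun hb => ?_) (fun hb => ?_)).mono
    (by simp [Test.cost, NExpr.cost]; omega) fun _ h => h
  · refine (hψ s' hs').mono (by omega) fun s'' ⟨hs'', hrep'⟩ => ⟨hs'', ?_⟩
    simpa only [Holds, hguard.1 hb, true_and] using hrep'
  · rw [hguard] at hb
    exact (HaltsWithin.skip ⟨hs', fun h => absurd h.1 hb, fun _ => hrep.2 hb⟩).mono
      (by omega) fun _ h => h

theorem LoopInv.step {start v : ℕ} (hD : 4 ≤ D) (hlinks : ∀ v ≠ 0, s₀.nat tailArray v < v)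
    (hp : φ.EvaluatedBy (D + 1) (s₀.setNat D 0 v) T p)
    (h : LoopInv φ τ V D start s₀ v s) (hguard : (quantifierGuard D).Holds s) :
    HaltsWithin (.seq p (.natStore D (.lit 0) (τ.nextExpr D))) s (T + 6)
      fun s' => ∃ v' < v, LoopInv φ τ V D start s₀ v' s' := by
  obtain ⟨hv, hone⟩ := (quantifierGuard_holds hD h.agree).1 hguard
  refine (HaltsWithin.seq (hp s h.agree) fun s' ⟨hs', hrep⟩ => .natStore
    ⟨τ.next s₀ v, τ.next_lt hlinks hv, (τ.next_lt hlinks hv).le.trans h.le, ?_, ?_, ?_⟩).mono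
      (by have := τ.nextExpr_cost_le D; simp only [NExpr.cost]; omega) fun _ h => h
  · rw [τ.nextExpr_eval hD hs']
    exact hs'.of_setNat.setNat _
  all_goals rw [Memory.setNat_nat_of_ne _ _ _ (by omega : resultReg ≠ D)]
  · by_cases hφ : φ.Holds (D + 1) (s₀.setNat D 0 v)
    · exact .inr (hrep.1 hφ)
    · exact .inl (hrep.2 hφ)
  · rw [h.holds_iff, hrep.iff]
    simp only [Visits.iff_of_ne_zero hv, forall_eq_or_imp, hone, true_and]

theorem evaluatedBy_all {e : NExpr} (hD : 4 ≤ D) (hlinks : ∀ v ≠ 0, s₀.nat tailArray v < v)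
    (he : e.Below D) (hV : e.eval s₀ ≤ V)
    (hp : ∀ v ≤ V, φ.EvaluatedBy (D + 1) (s₀.setNat D 0 v) T p) :
    (all τ e φ).EvaluatedBy D s₀ (e.cost + 16 + V * (T + 17))
      (.seq (.natStore D (.lit 0) e) <| .seq (.natStore resultReg (.lit 0) (.lit 1)) <|
        .loop (quantifierGuard D) (.seq p (.natStore D (.lit 0) (τ.nextExpr D)))) := by
  intro s hs
  set start := e.eval s₀ with hstart
  have hdone : ∀ v s, LoopInv φ τ V D start s₀ v s → ¬ (quantifierGuard D).Holds s →
      Agree D s₀ s ∧ s.Reports ((all τ e φ).Holds D s₀) := by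
    intro v s h hguard
    rw [quantifierGuard_holds hD h.agree] at hguard
    refine ⟨h.agree.of_setNat, fun hall => (h.holds_iff.1 hall).1, fun hall => ?_⟩
    refine h.bool.resolve_right fun hone => hall (h.holds_iff.2 ⟨hone, fun w hw => ?_⟩)
    rw [show v = 0 by tauto] at hw
    exact absurd hw Visits.not_zero
  have hloop s (h : LoopInv φ τ V D start s₀ start s) :=
    HaltsWithin.loop hdone (fun v _ h => h.step hD hlinks (hp v h.le)) h
  refine (HaltsWithin.seq (T := e.cost + 2) (T' := 14 + start * (T + 17))
    (Q := (s.setNat D 0 start = ·)) ?_ ?_).mono ?_ fun _ h => h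
  · rw [hstart, ← NExpr.eval_congr hs e he]
    exact (HaltsWithin.natStore rfl).mono (by simp only [NExpr.cost]; omega) fun _ h => h
  · rintro _ rfl
    refine (HaltsWithin.seq (.natStore ?_) hloop).mono
      (by simp only [quantifierGuard, Test.cost, NExpr.cost]; ring_nf; omega) fun _ h => h
    refine ⟨hV, (hs.setNat _).setResult _, .inr (Memory.setNat_nat_self ..), ?_⟩
    simp only [NExpr.eval, Memory.setNat_nat_self, true_and]
  · have := Nat.mul_le_mul_right (T + 17) hV
    omega

theorem evaluatedBy_compile (hD : 4 ≤ D) (hbelow : φ.Below D)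
    (hlinks : ∀ v ≠ 0, s₀.nat tailArray v < v) (hbounded : φ.Bounded V D s₀) :
    φ.EvaluatedBy D s₀ (φ.costBound V) (φ.compile D) := by
  induction φ generalizing D s₀ with
  | test b => exact evaluatedBy_test hbelow
  | not φ ih => exact (ih hD hbelow hlinks hbounded).not
  | and φ ψ ihφ ihψ =>
    exact (ihφ hD hbelow.1 hlinks hbounded.1).and (ihψ hD hbelow.2 hlinks hbounded.2)
  | all τ e φ ih =>
    refine evaluatedBy_all hD hlinks hbelow.1 hbounded.1 fun v hv =>
      ih (by omega) hbelow.2 (fun w hw => ?_) (hbounded.2 v hv)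
    rw [Memory.setNat_nat_of_ne _ _ _ (by omega)]
    exact hlinks w hw

end Correctness

end Formula

end RealRAM

/-! ### Cutting a separated set of points by a hyperplane -/

namespace Packing

open Finset

section Cut

variable {ι : Type*} {d r : ℕ} {x : ι → Fin d → ℝ} {f : ι → ℝ} {S : Finset ι}

/-- Distinct points among the `x p`, `p ∈ S`, are more than `1 / r` apart in some coordinate. -/
def Separated (r : ℕ) (x : ι → Fin d → ℝ) (S : Finset ι) : Prop :=
  (S : Set ι).Pairwise fun p q => ∃ j, 1 < r * |x p j - x q j|

theorem abs_sub_lt_one_of_floor_eq {y z : ℝ} (hy : 0 ≤ y) (hz : 0 ≤ z) (h : ⌊y⌋₊ = ⌊z⌋₊) :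
    |y - z| < 1 := by
  have hyz := Nat.floor_le hy
  have hyz' := Nat.lt_floor_add_one y
  rw [h] at hyz hyz'
  rw [abs_sub_lt_iff]
  constructor <;> linarith [Nat.floor_le hz, Nat.lt_floor_add_one z]

theorem Separated.card_le_of_box (hS : Separated r x S) (lo : Fin d → ℝ) (w : Fin d → ℕ)
    (hbox : ∀ p ∈ S, ∀ j, lo j ≤ x p j ∧ x p j ≤ lo j + w j) :
    #S ≤ ∏ j, (w j * r + 1) := by
  let cell : ι → Fin d → ℕ := fun p j => ⌊(x p j - lo j) * r⌋₊
  have hcell : ∀ p ∈ S, cell p ∈ Fintype.piFinset fun j => range (w j * r + 1) := by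
    intro p hp
    refine Fintype.mem_piFinset.2 fun j => mem_range_succ_iff.2 (Nat.floor_le_of_le ?_)
    push_cast
    exact mul_le_mul_of_nonneg_right (by linarith [(hbox p hp j).2]) r.cast_nonneg
  have hinj : Set.InjOn cell S := by
    intro p hp q hq hpq
    by_contra hne
    obtain ⟨j, hj⟩ := hS hp hq hne
    have hnonneg : ∀ u ∈ S, 0 ≤ (x u j - lo j) * r := fun u hu =>
      mul_nonneg (sub_nonneg.2 (hbox u hu j).1) r.cast_nonneg
    have hlt := abs_sub_lt_one_of_floor_eq (hnonneg p hp) (hnonneg q hq) (congrFun hpq j)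
    rw [← sub_mul, sub_sub_sub_cancel_right, abs_mul, Nat.abs_cast, mul_comm] at hlt
    exact lt_asymm hlt hj
  calc #S ≤ #(Fintype.piFinset fun j => range (w j * r + 1)) :=
        card_le_card_of_injOn cell hcell hinj
    _ = ∏ j, (w j * r + 1) := by simp only [Fintype.card_piFinset, card_range]

/-- The points of `S` in the slab of width `4` around the hyperplane on which `f` is `τ`. -/
noncomputable def slab (f : ι → ℝ) (S : Finset ι) (τ : ℝ) : Finset ι :=
  {u ∈ S | τ - 2 ≤ f u ∧ f u < τ + 2}

/-- The hyperplane on which `f` is `τ` properly divides `S`, with at most `K` points near it. -/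
structure IsSparseCut (f : ι → ℝ) (S : Finset ι) (K τ : ℝ) : Prop where
  exists_lt : ∃ u ∈ S, f u < τ
  exists_ge : ∃ u ∈ S, τ ≤ f u
  card_slab_le : (#(slab f S τ) : ℝ) ≤ K

theorem exists_sparse_strip {A : ℕ} {K : ℝ} (hA : 0 < A) (hcard : (#S : ℝ) ≤ A * K) (f : ι → ℝ)
    (a : ℝ) : ∃ i < A, (#{u ∈ S | a + 5 * i ≤ f u ∧ f u < a + 5 * i + 5} : ℝ) ≤ K := by
  obtain ⟨i, hi, hK⟩ := exists_card_fiber_le_of_card_le_nsmul (s := S) (t := range A)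
    (f := fun u => ⌊(f u - a) / 5⌋₊) (b := K) ⟨0, mem_range.2 hA⟩ (by simpa using hcard)
  refine ⟨i, mem_range.1 hi, le_trans (Nat.cast_le.2 (card_le_card ?_)) hK⟩
  refine monotone_filter_right _ fun u _ ⟨hlo, hhi⟩ => ?_
  rw [Nat.floor_eq_iff (div_nonneg (by linarith [Nat.cast_nonneg (α := ℝ) i]) (by norm_num)),
    le_div_iff₀ (by norm_num), div_lt_iff₀ (by norm_num)]
  exact ⟨by linarith [hlo], by linarith [hhi]⟩

/-- The cut lies a distance `3` behind the last point `p` with `f p ≤ f a + 5 * i`, so that the slab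
around it meets `S` only in the sparse strip between `f a + 5 * i` and `f a + 5 * i + 5`. -/
theorem exists_sparseCut_of_long {A : ℕ} {K : ℝ} (hA : 0 < A) (hcard : (#S : ℝ) ≤ A * K)
    {a b : ι} (ha : a ∈ S) (hb : b ∈ S) (hab : 5 * (A : ℝ) ≤ f b - f a) :
    ∃ p ∈ S, IsSparseCut f S K (f p + 3) := by
  obtain ⟨i, hi, hK⟩ := exists_sparse_strip hA hcard f (f a)
  have hiA : (i : ℝ) + 1 ≤ A := by exact_mod_cast hi
  obtain ⟨p, hp, hpmax⟩ := exists_max_image {u ∈ S | f u ≤ f a + 5 * i} f ⟨a, by simp [ha]⟩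
  rw [mem_filter] at hp
  refine ⟨p, hp.1, ⟨p, hp.1, by linarith⟩, ⟨b, hb, by linarith [hp.2]⟩, le_trans ?_ hK⟩
  refine Nat.cast_le.2 (card_le_card fun u hu => ?_)
  obtain ⟨huS, hlo, hhi⟩ := mem_filter.1 hu
  refine mem_filter.2 ⟨huS, ?_, by linarith [hp.2]⟩
  by_contra! hlt
  linarith [hpmax u (mem_filter.2 ⟨huS, hlt.le⟩)]

theorem Separated.card_slab_le_of_short (hS : Separated r x S) {A : ℕ}
    (hshort : ∀ j, ∀ a ∈ S, ∀ b ∈ S, x b j - x a j < 5 * A) (j : Fin d) (τ : ℝ) :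
    #(slab (x · j) S τ) ≤ (4 * r + 1) * (5 * A * r + 1) ^ (d - 1) := by
  rcases S.eq_empty_or_nonempty with rfl | hne
  · simp [slab]
  choose m hm hmin using fun i => exists_min_image S (x · i) hne
  have hslab : slab (x · j) S τ ⊆ S := filter_subset _ _
  have hcard := Separated.card_le_of_box (Set.Pairwise.mono (coe_subset.2 hslab) hS)
    (fun i => if i = j then τ - 2 else x (m i) i) (fun i => if i = j then 4 else 5 * A) (by
      intro p hp i
      obtain ⟨hpS, hlo, hhi⟩ := mem_filter.1 hp
      split_ifs with hij
      · subst hij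
        push_cast
        constructor <;> linarith
      · push_cast
        exact ⟨hmin i p hpS, by linarith [hshort i (m i) (hm i) p hpS]⟩)
  refine hcard.trans_eq ?_
  rw [← mul_prod_erase _ _ (mem_univ j), if_pos rfl, prod_congr rfl
    (g := fun _ => 5 * A * r + 1) fun i hi => by rw [if_neg (ne_of_mem_erase hi)],
    prod_const, card_erase_of_mem (mem_univ j), card_univ, Fintype.card_fin]

theorem rpow_one_div_mul_rpow_one_sub {k : ℝ} (hk : 0 < k) (y : ℝ) :
    k ^ (1 / y) * k ^ (1 - 1 / y) = k := by
  rw [← Real.rpow_add hk, add_sub_cancel, Real.rpow_one]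

theorem rpow_one_div_pow_pred {k : ℝ} (hk : 0 ≤ k) (hd : 0 < d) :
    (k ^ (1 / (d : ℝ))) ^ (d - 1) = k ^ (1 - 1 / (d : ℝ)) := by
  have hd' : (d : ℝ) ≠ 0 := by exact_mod_cast hd.ne'
  rw [← Real.rpow_natCast, ← Real.rpow_mul hk, Nat.cast_sub hd]
  congr 1
  field_simp
  simp

/-- A bound, up to the factor `k ^ (1 - 1 / d)`, for the number of points near a sparse cut. -/
def cutConst (d r : ℕ) : ℕ := (4 * r + 1) * (10 * r + 1) ^ (d - 1)

theorem short_count_le {A : ℕ} {L : ℝ} (hL : 1 ≤ L) (hA : (A : ℝ) ≤ 2 * L) :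
    (((4 * r + 1) * (5 * A * r + 1) ^ (d - 1) : ℕ) : ℝ) ≤ cutConst d r * L ^ (d - 1) := by
  have hbase : 5 * A * r + 1 ≤ (10 * r + 1) * L := by
    nlinarith [mul_le_mul_of_nonneg_right hA (Nat.cast_nonneg (α := ℝ) r)]
  calc (((4 * r + 1) * (5 * A * r + 1) ^ (d - 1) : ℕ) : ℝ)
      = (4 * r + 1) * (5 * A * r + 1) ^ (d - 1) := by push_cast; ring
    _ ≤ (4 * r + 1) * ((10 * r + 1) * L) ^ (d - 1) := by gcongr
    _ = cutConst d r * L ^ (d - 1) := by rw [mul_pow, cutConst]; push_cast; ring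

theorem Separated.exists_cut_of_sparse_slabs (hS : Separated r x S) (hcard : 2 ≤ #S) {K : ℝ}
    (hK : ∀ j τ, (#(slab (x · j) S τ) : ℝ) ≤ K) :
    ∃ j, ∃ p ∈ S, IsSparseCut (x · j) S K (x p j) := by
  obtain ⟨p, hp, q, hq, hpq⟩ := one_lt_card.1 hcard
  obtain ⟨j, hj⟩ := hS hp hq hpq
  have hne : x p j ≠ x q j := by
    rintro heq
    norm_num [heq] at hj
  rcases hne.lt_or_gt with hlt | hlt
  · exact ⟨j, q, hq, ⟨p, hp, hlt⟩, ⟨q, hq, le_rfl⟩, hK j _⟩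
  · exact ⟨j, p, hp, ⟨q, hq, hlt⟩, ⟨p, hp, le_rfl⟩, hK j _⟩

theorem Separated.exists_cut (hS : Separated r x S) {k : ℕ} (hcard : 2 ≤ #S) (hk : #S ≤ k) :
    ∃ j, ∃ p ∈ S, ∃ σ : ℝ, (σ = 0 ∨ σ = 3) ∧
      IsSparseCut (x · j) S (cutConst d r * (k : ℝ) ^ (1 - 1 / (d : ℝ))) (x p j + σ) := by
  have hk1 : (1 : ℝ) ≤ k := by exact_mod_cast (show 1 ≤ k by omega)
  have hd : 0 < d := by
    obtain ⟨p, hp, q, hq, hpq⟩ := one_lt_card.1 hcard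
    exact (hS hp hq hpq).choose.pos
  set L : ℝ := (k : ℝ) ^ (1 / (d : ℝ))
  set K : ℝ := (k : ℝ) ^ (1 - 1 / (d : ℝ)) with hK
  have hL : 1 ≤ L := Real.one_le_rpow hk1 (by positivity)
  have hA : 0 < ⌈L⌉₊ := Nat.ceil_pos.2 (by linarith)
  by_cases hshort : ∀ j, ∀ a ∈ S, ∀ b ∈ S, x b j - x a j < 5 * (⌈L⌉₊ : ℝ)
  · obtain ⟨j, p, hp, hcut⟩ := hS.exists_cut_of_sparse_slabs hcard
      (K := cutConst d r * K) fun j τ => by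
        rw [hK, ← rpow_one_div_pow_pred (zero_le_one.trans hk1) hd]
        exact (Nat.cast_le.2 (hS.card_slab_le_of_short hshort j τ)).trans
          (short_count_le hL (by linarith [Nat.ceil_lt_add_one (zero_le_one.trans hL)]))
    exact ⟨j, p, hp, 0, .inl rfl, by simpa only [add_zero] using hcut⟩
  · push Not at hshort
    obtain ⟨j, a, ha, b, hb, hab⟩ := hshort
    have hcount : (#S : ℝ) ≤ ⌈L⌉₊ * K := by
      calc (#S : ℝ) ≤ k := by exact_mod_cast hk
        _ = L * K := (rpow_one_div_mul_rpow_one_sub (by linarith) _).symm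
        _ ≤ ⌈L⌉₊ * K := by gcongr; exact Nat.le_ceil L
    obtain ⟨p, hp, hcut⟩ := exists_sparseCut_of_long (f := (x · j)) hA hcount ha hb hab
    have hconst : (1 : ℝ) ≤ cutConst d r := by
      exact_mod_cast Nat.succ_le_of_lt (show 0 < cutConst d r by unfold cutConst; positivity)
    exact ⟨j, p, hp, 3, .inr rfl, hcut.exists_lt, hcut.exists_ge,
      hcut.card_slab_le.trans (le_mul_of_one_le_left (by positivity) hconst)⟩

end Cut

end Packing

/-! ### Facts about packings and their derivation -/

namespace Packing

open Finset

section Facts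

/-- The half-open box of the points `y` with `lo j ≤ y j < hi j` for all `j`. -/
structure Box (d : ℕ) where
  lo : Fin d → ℝ
  hi : Fin d → ℝ

namespace Box

variable {d : ℕ} {B B' : Box d} {y : Fin d → ℝ}

/-- The point `y` lies in the box. -/
def Contains (B : Box d) (y : Fin d → ℝ) : Prop := ∀ j, B.lo j ≤ y j ∧ y j < B.hi j

/-- The point `y`, assumed to lie in the box, has distance at most `2` from some face. -/
def Near (B : Box d) (y : Fin d → ℝ) : Prop := ∃ j, y j < B.lo j + 2 ∨ B.hi j - 2 ≤ y j

instance : LE (Box d) := ⟨fun B B' => B'.lo ≤ B.lo ∧ B.hi ≤ B'.hi⟩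

theorem Contains.mono (hB : B ≤ B') (hy : B.Contains y) : B'.Contains y :=
  fun j => ⟨(hB.1 j).trans (hy j).1, (hy j).2.trans_le (hB.2 j)⟩

theorem Near.anti (hB : B ≤ B') (hy : B'.Near y) : B.Near y := by
  obtain ⟨j, hj⟩ := hy
  exact ⟨j, hj.imp (fun h => by linarith [hB.1 j]) (fun h => by linarith [hB.2 j])⟩

/-- The part of the box below the hyperplane with `j`-th coordinate `τ`. -/
def below (B : Box d) (j : Fin d) (τ : ℝ) : Box d := { B with hi := Function.update B.hi j τ }

/-- The part of the box above the hyperplane with `j`-th coordinate `τ`. -/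
def above (B : Box d) (j : Fin d) (τ : ℝ) : Box d := { B with lo := Function.update B.lo j τ }

theorem below_le {j : Fin d} {τ : ℝ} (hτ : τ ≤ B.hi j) : B.below j τ ≤ B :=
  ⟨le_rfl, update_le_self_iff.2 hτ⟩

theorem above_le {j : Fin d} {τ : ℝ} (hτ : B.lo j ≤ τ) : B.above j τ ≤ B :=
  ⟨le_update_self_iff.2 hτ, le_rfl⟩

end Box

/-- A statement about a family of points indexed by `ι`: there is a packing of `count` of them in
`box` such that those near the boundary of the box belong to `points`. -/
structure Fact (ι : Type*) (d : ℕ) where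
  count : ℕ
  box : Box d
  points : Set ι

variable {ι : Type*} {d : ℕ} (x : ι → Fin d → ℝ) (U : Finset ι)
  (R : (Fin d → ℝ) → (Fin d → ℝ) → Prop)

/-- No two of the points `x p`, `p ∈ P`, are in conflict according to `R`. -/
def IsPacking (P : Set ι) : Prop := P.Pairwise fun p q => ¬ R (x p) (x q)

namespace Fact

/-- The set `P` shows that the fact `φ` is true. -/
structure Witness (φ : Fact ι d) (P : Finset ι) : Prop where
  subset : P ⊆ U
  card_eq : #P = φ.count
  isPacking : IsPacking x R P
  contains : ∀ p ∈ P, φ.box.Contains (x p)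
  near : ∀ p ∈ P, φ.box.Near (x p) → p ∈ φ.points

/-- The fact `φ` is true. -/
def Valid (φ : Fact ι d) : Prop := ∃ P, φ.Witness x U R P

/-- The fact `φ` is about a single point. -/
def IsBase (φ : Fact ι d) : Prop := φ.count = 1 ∧ ∃ p ∈ φ.points, p ∈ U ∧ φ.box.Contains (x p)

/-- Packings on the two sides of a hyperplane, as claimed by `φ₁` and `φ₂`, can be united to one as
claimed by `φ`; the conflicts between them are seen in `φ₁.points` and `φ₂.points`. -/
structure Joins (φ₁ φ₂ φ : Fact ι d) : Prop where
  count_eq : φ.count = φ₁.count + φ₂.count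
  exists_le : ∃ j, φ₁.box.hi j ≤ φ₂.box.lo j
  le_left : φ₁.box ≤ φ.box
  le_right : φ₂.box ≤ φ.box
  not_conflict : ∀ p ∈ φ₁.points, ∀ q ∈ φ₂.points, ¬ R (x p) (x q)
  keeps_left : ∀ p ∈ φ₁.points, φ.box.Near (x p) → p ∈ φ.points
  keeps_right : ∀ p ∈ φ₂.points, φ.box.Near (x p) → p ∈ φ.points

/-- Derivability in a given number of rounds, all facts being taken from `A`. -/
inductive Derivable (A : Set (Fact ι d)) : ℕ → Fact ι d → Prop
  | base {i : ℕ} {φ : Fact ι d} : φ ∈ A → φ.IsBase x U → Derivable A (i + 1) φ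
  | join {i : ℕ} {φ₁ φ₂ φ : Fact ι d} : φ ∈ A → Derivable A i φ₁ → Derivable A i φ₂ →
      Joins x R φ₁ φ₂ φ → Derivable A (i + 1) φ

variable {x U R} {φ φ₁ φ₂ : Fact ι d} {P₁ P₂ : Finset ι}

theorem IsBase.valid (h : φ.IsBase x U) : φ.Valid x U R := by
  obtain ⟨hcount, p, hp, hpU, hbox⟩ := h
  exact ⟨{p}, by simpa using hpU, by simp [hcount], by simp [IsPacking], by simpa using hbox,
    by simpa using fun _ => hp⟩

/-- Points on the two sides of the hyperplane in conflict are within distance `2` of it, hence near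
the boundaries of both boxes. -/
theorem Joins.not_conflict_of_witness (hclose : ∀ y z, R y z → ∀ j, |y j - z j| ≤ 2)
    (h : Joins x R φ₁ φ₂ φ) (h₁ : φ₁.Witness x U R P₁) (h₂ : φ₂.Witness x U R P₂) {p q : ι}
    (hp : p ∈ P₁) (hq : q ∈ P₂) : ¬ R (x p) (x q) := by
  intro hR
  obtain ⟨j, hj⟩ := h.exists_le
  have hpq := abs_le.1 (hclose _ _ hR j)
  have hpj := (h₁.contains p hp j).2
  have hqj := (h₂.contains q hq j).1
  exact h.not_conflict p (h₁.near p hp ⟨j, .inr (by linarith)⟩)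
    q (h₂.near q hq ⟨j, .inl (by linarith)⟩) hR

theorem Joins.valid (hsymm : ∀ y z, R y z → R z y)
    (hclose : ∀ y z, R y z → ∀ j, |y j - z j| ≤ 2) (h : Joins x R φ₁ φ₂ φ)
    (h₁ : φ₁.Valid x U R) (h₂ : φ₂.Valid x U R) : φ.Valid x U R := by
  classical
  obtain ⟨P₁, h₁⟩ := h₁
  obtain ⟨P₂, h₂⟩ := h₂
  have hcross : ∀ p ∈ P₁, ∀ q ∈ P₂, ¬ R (x p) (x q) := fun p hp q hq =>
    h.not_conflict_of_witness hclose h₁ h₂ hp hq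
  have hdisj : Disjoint P₁ P₂ := Finset.disjoint_left.2 fun p hp hp' => by
    obtain ⟨j, hj⟩ := h.exists_le
    linarith [(h₁.contains p hp j).2, (h₂.contains p hp' j).1]
  refine ⟨P₁ ∪ P₂, union_subset h₁.subset h₂.subset, ?_, ?_, fun p hp => ?_, fun p hp hnear => ?_⟩
  · rw [card_union_of_disjoint hdisj, h₁.card_eq, h₂.card_eq, h.count_eq]
  · rw [IsPacking, coe_union, Set.pairwise_union]
    exact ⟨h₁.isPacking, h₂.isPacking, fun p hp q hq _ =>
      ⟨hcross p hp q hq, fun hR => hcross p hp q hq (hsymm _ _ hR)⟩⟩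
  · rcases mem_union.1 hp with hp | hp
    · exact (h₁.contains p hp).mono h.le_left
    · exact (h₂.contains p hp).mono h.le_right
  · rcases mem_union.1 hp with hp | hp
    · exact h.keeps_left p (h₁.near p hp (hnear.anti h.le_left)) hnear
    · exact h.keeps_right p (h₂.near p hp (hnear.anti h.le_right)) hnear

variable {A : Set (Fact ι d)} {i k : ℕ}

theorem Derivable.mem : Derivable x U R A i φ → φ ∈ A
  | .base hA _ => hA
  | .join hA _ _ _ => hA

theorem Derivable.mono (h : Derivable x U R A i φ) (hik : i ≤ k) : Derivable x U R A k φ := by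
  induction h generalizing k with
  | base hA hbase =>
    cases k with
    | zero => omega
    | succ k => exact .base hA hbase
  | join hA _ _ hjoin ih₁ ih₂ =>
    cases k with
    | zero => omega
    | succ k => exact .join hA (ih₁ (by omega)) (ih₂ (by omega)) hjoin

end Fact

/-! ### Every packing is derivable -/

/-- The positions of the faces of boxes orthogonal to the `j`-th axis. -/
def sides (j : Fin d) : Set ℝ := {t | ∃ p ∈ U, ∃ σ : ℝ, (σ = 0 ∨ σ = 3 ∨ σ = -3) ∧ t = x p j + σ}

/-- The facts about boxes with faces in `sides x U` that mention at most `M` points. -/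
def facts (M : ℕ) : Set (Fact ι d) :=
  {φ | φ.count ≠ 0 ∧ φ.count ≤ #U ∧ (∀ j, φ.box.lo j ∈ sides x U j ∧ φ.box.hi j ∈ sides x U j) ∧
    ∃ F ⊆ U, #F ≤ M ∧ φ.points = F}

/-- The box contains `S`, its faces are in `sides x U`, and at most `K` points of `S` are near each
face. -/
structure Fits (K : ℝ) (B : Box d) (S : Finset ι) : Prop where
  mem_sides : ∀ j, B.lo j ∈ sides x U j ∧ B.hi j ∈ sides x U j
  contains : ∀ p ∈ S, B.Contains (x p)
  card_lo : ∀ j, (#{p ∈ S | x p j < B.lo j + 2} : ℝ) ≤ K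
  card_hi : ∀ j, (#{p ∈ S | B.hi j - 2 ≤ x p j} : ℝ) ≤ K

open Classical in
/-- The points of `S` near the boundary of the box. -/
noncomputable def nearPoints (B : Box d) (S : Finset ι) : Finset ι := {p ∈ S | B.Near (x p)}

variable {x U R} {K : ℝ} {B : Box d} {S : Finset ι} {j : Fin d} {τ : ℝ}

theorem mem_nearPoints {p : ι} : p ∈ nearPoints x B S ↔ p ∈ S ∧ B.Near (x p) := by
  classical exact mem_filter

theorem Fits.card_nearPoints_le (h : Fits x U K B S) : (#(nearPoints x B S) : ℝ) ≤ 2 * d * K := by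
  classical
  have hsub : nearPoints x B S ⊆ univ.biUnion fun j =>
      {p ∈ S | x p j < B.lo j + 2} ∪ {p ∈ S | B.hi j - 2 ≤ x p j} := by
    intro p hp
    obtain ⟨hpS, j, hj⟩ := mem_nearPoints.1 hp
    simp only [mem_biUnion, mem_univ, true_and, mem_union, mem_filter]
    exact ⟨j, hj.imp (⟨hpS, ·⟩) (⟨hpS, ·⟩)⟩
  calc (#(nearPoints x B S) : ℝ)
      ≤ ∑ j, ((#{p ∈ S | x p j < B.lo j + 2} : ℝ) + #{p ∈ S | B.hi j - 2 ≤ x p j}) := by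
        exact_mod_cast (card_le_card hsub).trans
          (card_biUnion_le.trans (sum_le_sum fun j _ => card_union_le _ _))
    _ ≤ ∑ _j : Fin d, (K + K) := sum_le_sum fun j _ => add_le_add (h.card_lo j) (h.card_hi j)
    _ = 2 * d * K := by rw [sum_const, card_univ, Fintype.card_fin, nsmul_eq_mul]; ring

theorem Fits.below (h : Fits x U K B S) (hτ : τ ∈ sides x U j)
    (hslab : (#(slab (x · j) S τ) : ℝ) ≤ K) : Fits x U K (B.below j τ) {p ∈ S | x p j < τ} where
  mem_sides i := by
    refine ⟨(h.mem_sides i).1, ?_⟩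
    rcases eq_or_ne i j with rfl | hij
    · simpa [Box.below] using hτ
    · simpa [Box.below, hij] using (h.mem_sides i).2
  contains p hp i := by
    rw [mem_filter] at hp
    refine ⟨(h.contains p hp.1 i).1, ?_⟩
    rcases eq_or_ne i j with rfl | hij
    · simpa [Box.below] using hp.2
    · simpa [Box.below, hij] using (h.contains p hp.1 i).2
  card_lo i := (Nat.cast_le.2 (card_le_card (filter_subset_filter _ (filter_subset _ _)))).trans
    (h.card_lo i)
  card_hi i := by
    rcases eq_or_ne i j with rfl | hij
    · refine (Nat.cast_le.2 (card_le_card fun p hp => ?_)).trans hslab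
      simp only [Box.below, Function.update_self, mem_filter, slab] at hp ⊢
      exact ⟨hp.1.1, hp.2, by linarith [hp.1.2]⟩
    · simpa [Box.below, hij] using (Nat.cast_le.2 (card_le_card
        (filter_subset_filter _ (filter_subset _ _)))).trans (h.card_hi i)

theorem Fits.above (h : Fits x U K B S) (hτ : τ ∈ sides x U j)
    (hslab : (#(slab (x · j) S τ) : ℝ) ≤ K) : Fits x U K (B.above j τ) {p ∈ S | ¬ x p j < τ} where
  mem_sides i := by
    refine ⟨?_, (h.mem_sides i).2⟩
    rcases eq_or_ne i j with rfl | hij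
    · simpa [Box.above] using hτ
    · simpa [Box.above, hij] using (h.mem_sides i).1
  contains p hp i := by
    rw [mem_filter] at hp
    refine ⟨?_, (h.contains p hp.1 i).2⟩
    rcases eq_or_ne i j with rfl | hij
    · simpa [Box.above] using hp.2
    · simpa [Box.above, hij] using (h.contains p hp.1 i).1
  card_lo i := by
    rcases eq_or_ne i j with rfl | hij
    · refine (Nat.cast_le.2 (card_le_card fun p hp => ?_)).trans hslab
      simp only [Box.above, Function.update_self, mem_filter, slab] at hp ⊢
      exact ⟨hp.1.1, by linarith [hp.1.2], hp.2⟩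
    · simpa [Box.above, hij] using (Nat.cast_le.2 (card_le_card
        (filter_subset_filter _ (filter_subset _ _)))).trans (h.card_lo i)
  card_hi i := (Nat.cast_le.2 (card_le_card (filter_subset_filter _ (filter_subset _ _)))).trans
    (h.card_hi i)

theorem Fits.mem_facts (h : Fits x U K B S) (hS : S ⊆ U) (hne : S.Nonempty) {M : ℕ} {F : Finset ι}
    (hF : F ⊆ S) (hM : #F ≤ M) : ⟨#S, B, F⟩ ∈ facts x U M :=
  ⟨hne.card_pos.ne', card_le_card hS, h.mem_sides, F, hF.trans hS, hM, rfl⟩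

theorem Fits.joins (h : Fits x U K B S) (hpack : IsPacking x R S)
    (hcut : IsSparseCut (x · j) S K τ) {F₁ F₂ : Finset ι}
    (hF₁ : F₁ ⊆ {p ∈ S | x p j < τ}) (hF₂ : F₂ ⊆ {p ∈ S | ¬ x p j < τ}) :
    Fact.Joins x R ⟨#{p ∈ S | x p j < τ}, B.below j τ, F₁⟩ ⟨#{p ∈ S | ¬ x p j < τ}, B.above j τ, F₂⟩
      ⟨#S, B, nearPoints x B S⟩ where
  count_eq := (card_filter_add_card_filter_not _).symm
  exists_le := ⟨j, by simp [Box.below, Box.above]⟩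
  le_left := by
    obtain ⟨p, hp, hpτ⟩ := hcut.exists_ge
    exact Box.below_le (hpτ.trans (h.contains p hp j).2.le)
  le_right := by
    obtain ⟨p, hp, hpτ⟩ := hcut.exists_lt
    exact Box.above_le ((h.contains p hp j).1.trans hpτ.le)
  not_conflict p hp q hq := by
    have hp' := mem_filter.1 (hF₁ hp)
    have hq' := mem_filter.1 (hF₂ hq)
    exact hpack hp'.1 hq'.1 fun hpq => hq'.2 (hpq ▸ hp'.2)
  keeps_left p hp hnear := mem_nearPoints.2 ⟨(mem_filter.1 (hF₁ hp)).1, hnear⟩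
  keeps_right p hp hnear := mem_nearPoints.2 ⟨(mem_filter.1 (hF₂ hp)).1, hnear⟩

theorem IsPacking.separated {r : ℕ} (hfar : ∀ y z, (∀ j, (r : ℝ) * |y j - z j| ≤ 1) → R y z)
    (hpack : IsPacking x R S) : Separated r x S :=
  hpack.imp fun p q hpq => by
    by_contra! hle
    exact hpq (hfar _ _ hle)

theorem Fits.exists_derivable {r k M : ℕ} (hfar : ∀ y z, (∀ j, (r : ℝ) * |y j - z j| ≤ 1) → R y z)
    (hK : K = cutConst d r * (k : ℝ) ^ (1 - 1 / (d : ℝ))) (hM0 : 0 < M) (hM : 2 * d * K ≤ M)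
    (hfit : Fits x U K B S) (hne : S.Nonempty) (hSU : S ⊆ U) (hSk : #S ≤ k)
    (hpack : IsPacking x R S) :
    ∃ F ⊆ S, Fact.Derivable x U R (facts x U M) #S ⟨#S, B, F⟩ := by
  induction hs : #S using Nat.strong_induction_on generalizing S B with
  | _ s ih =>
  subst hs
  obtain hone | htwo : #S = 1 ∨ 2 ≤ #S := by have := hne.card_pos; omega
  · refine ⟨S, subset_rfl, .mono ?_ hne.card_pos⟩
    obtain ⟨p, rfl⟩ := card_eq_one.1 hone
    exact .base (hfit.mem_facts hSU hne subset_rfl (hone.trans_le hM0)) ⟨hone, p, by simp,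
      hSU (mem_singleton_self p), hfit.contains p (mem_singleton_self p)⟩
  · obtain ⟨j, p, hp, σ, hσ, hcut⟩ := (hpack.separated hfar).exists_cut htwo hSk
    rw [← hK] at hcut
    have hτ : x p j + σ ∈ sides x U j := ⟨p, hSU hp, σ, by tauto, rfl⟩
    set τ := x p j + σ
    obtain ⟨u, hu, huτ⟩ := hcut.exists_lt
    obtain ⟨v, hv, hvτ⟩ := hcut.exists_ge
    have hsum := card_filter_add_card_filter_not (s := S) fun u => x u j < τ
    have hne₁ : {u ∈ S | x u j < τ}.Nonempty := ⟨u, mem_filter.2 ⟨hu, huτ⟩⟩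
    have hne₂ : {u ∈ S | ¬ x u j < τ}.Nonempty := ⟨v, mem_filter.2 ⟨hv, not_lt.2 hvτ⟩⟩
    have hpos₁ := hne₁.card_pos
    have hpos₂ := hne₂.card_pos
    obtain ⟨F₁, hF₁, hd₁⟩ := ih _ (by omega) (hfit.below hτ hcut.card_slab_le) hne₁
      ((filter_subset _ _).trans hSU) (by omega)
      (hpack.mono (coe_subset.2 (filter_subset _ _))) rfl
    obtain ⟨F₂, hF₂, hd₂⟩ := ih _ (by omega) (hfit.above hτ hcut.card_slab_le) hne₂
      ((filter_subset _ _).trans hSU) (by omega)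
      (hpack.mono (coe_subset.2 (filter_subset _ _))) rfl
    have hnear : nearPoints x B S ⊆ S := fun p hp => (mem_nearPoints.1 hp).1
    have hmem := hfit.mem_facts hSU hne hnear (M := M)
      (by exact_mod_cast hfit.card_nearPoints_le.trans hM)
    refine ⟨_, hnear, .mono (.join (i := #S - 1) hmem (hd₁.mono (by omega)) (hd₂.mono (by omega))
      (hfit.joins hpack hcut hF₁ hF₂)) (by omega)⟩

theorem Fact.exists_derivable_of_isPacking {r M : ℕ}
    (hfar : ∀ y z, (∀ j, (r : ℝ) * |y j - z j| ≤ 1) → R y z) (hM0 : 0 < M)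
    (hM : 2 * d * (cutConst d r * (#S : ℝ) ^ (1 - 1 / (d : ℝ))) ≤ M) (hne : S.Nonempty)
    (hSU : S ⊆ U) (hpack : IsPacking x R S) :
    ∃ φ : Fact ι d, φ.count = #S ∧ φ.Derivable x U R (facts x U M) #S := by
  choose a ha hmin using fun j => exists_min_image S (x · j) hne
  choose b hb hmax using fun j => exists_max_image S (x · j) hne
  have hK : 0 ≤ cutConst d r * (#S : ℝ) ^ (1 - 1 / (d : ℝ)) := by unfold cutConst; positivity
  have hfit : Fits x U (cutConst d r * (#S : ℝ) ^ (1 - 1 / (d : ℝ)))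
      ⟨fun j => x (a j) j + -3, fun j => x (b j) j + 3⟩ S :=
    { mem_sides := fun j =>
        ⟨⟨a j, hSU (ha j), -3, by tauto, rfl⟩, ⟨b j, hSU (hb j), 3, by tauto, rfl⟩⟩
      contains := fun p hp j => ⟨by linarith [hmin j p hp], by linarith [hmax j p hp]⟩
      card_lo := fun j => by
        rwa [filter_eq_empty_iff.2 fun p hp => by linarith [hmin j p hp], card_empty, Nat.cast_zero]
      card_hi := fun j => by
        rwa [filter_eq_empty_iff.2 fun p hp => by linarith [hmax j p hp], card_empty,
          Nat.cast_zero] }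
  obtain ⟨F, -, hF⟩ := hfit.exists_derivable hfar rfl hM0 hM hne hSU le_rfl hpack
  exact ⟨_, rfl, hF⟩

end Facts

end Packing

/-! ### Facts as numbers -/

namespace Packing

open RealRAM

/-- The tables by which a number is read as a list of digits, the first of which is its `head` and
the others those of its `tail`, and the tables of the numbers that single digits stand for. -/
structure Tables (d : ℕ) where
  head : ℕ → ℕ
  tail : ℕ → ℕ
  point : ℕ → Fin d → ℝ
  shift : ℕ → ℝ

namespace Tables

variable {d : ℕ} (T : Tables d)

/-- The `i`-th digit of `f`. -/
def digit (i f : ℕ) : ℕ := T.head (T.tail^[i] f)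

/-- The number that the digits `i` and `i + 1` of `f` stand for: a shifted coordinate of a point. -/
def face (i f : ℕ) (j : Fin d) : ℝ := T.point (T.digit i f) j + T.shift (T.digit (i + 1) f)

/-- The fact that the number `f` stands for.  Its digits are the count, four for the faces of the
box in each direction, and the points, which are counted from `1` because a list ends at the number
`0`. -/
def read (f : ℕ) : Fact ℕ d where
  count := T.digit 0 f
  box := ⟨fun j => T.face (4 * j + 1) f j, fun j => T.face (4 * j + 3) f j⟩
  points := {p | ∃ g, Visits T.tail (T.tail^[4 * d + 1] f) g ∧ T.head g - 1 = p}

/-- The tables read the numbers below `V` in base `n + 3`, and the digits `0`, `1` and `2` stand for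
the three shifts of a face. -/
structure Encodes (n V : ℕ) : Prop where
  head : ∀ g < V, T.head g = g % (n + 3)
  tail : ∀ g < V, T.tail g = g / (n + 3)
  shift_zero : T.shift 0 = 0
  shift_one : T.shift 1 = 3
  shift_two : T.shift 2 = -3

namespace Encodes

variable {T} {n V : ℕ} {l : List ℕ}

theorem iterate_tail (h : T.Encodes n V) (hl : ∀ a ∈ l, a < n + 3)
    (hV : Nat.ofDigits (n + 3) l < V) (i : ℕ) :
    T.tail^[i] (Nat.ofDigits (n + 3) l) = Nat.ofDigits (n + 3) (l.drop i) ∧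
      Nat.ofDigits (n + 3) (l.drop i) < V := by
  induction i with
  | zero => exact ⟨rfl, hV⟩
  | succ i ih =>
    have hdiv : Nat.ofDigits (n + 3) (l.drop i) / (n + 3) = Nat.ofDigits (n + 3) (l.drop i).tail :=
      Nat.ofDigits_div_eq_ofDigits_tail (by omega) _ fun a ha => hl a (List.mem_of_mem_drop ha)
    rw [Function.iterate_succ_apply', ih.1, h.tail _ ih.2, ← List.tail_drop, ← hdiv]
    exact ⟨rfl, (Nat.div_le_self _ _).trans_lt ih.2⟩

theorem digit_ofDigits (h : T.Encodes n V) (hl : ∀ a ∈ l, a < n + 3)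
    (hV : Nat.ofDigits (n + 3) l < V) (i : ℕ) :
    T.digit i (Nat.ofDigits (n + 3) l) = l.getD i 0 := by
  obtain ⟨hdrop, hlt⟩ := h.iterate_tail hl hV i
  rw [digit, hdrop, h.head _ hlt]
  rcases lt_or_ge i l.length with hi | hi
  · rw [List.drop_eq_getElem_cons hi, Nat.ofDigits_cons, Nat.add_mul_mod_self_left,
      Nat.mod_eq_of_lt (hl _ (List.getElem_mem hi)), List.getD_eq_getElem _ _ hi]
  · rw [List.drop_eq_nil_of_le hi, List.getD_eq_default _ _ hi, Nat.ofDigits_nil, Nat.zero_mod]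

/-- A list ends at the number `0`, so its digits must not be `0`. -/
theorem exists_visits_iff (h : T.Encodes n V) (hl : ∀ a ∈ l, a < n + 3) (hl0 : ∀ a ∈ l, a ≠ 0)
    (hV : Nat.ofDigits (n + 3) l < V) (P : ℕ → Prop) :
    (∃ g, Visits T.tail (Nat.ofDigits (n + 3) l) g ∧ P (T.head g)) ↔ ∃ a ∈ l, P a := by
  induction l with
  | nil => simp [Visits.not_zero]
  | cons b l ih =>
    obtain ⟨htail, hlt⟩ := h.iterate_tail hl hV 1
    have hhead := h.digit_ofDigits hl hV 0
    have hne : Nat.ofDigits (n + 3) (b :: l) ≠ 0 := by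
      have := hl0 b List.mem_cons_self
      rw [Nat.ofDigits_cons]
      omega
    simp only [Function.iterate_one, List.drop_one, List.tail_cons] at htail hlt
    simp only [digit, Function.iterate_zero, id, List.getD_cons_zero] at hhead
    rw [List.forall_mem_cons] at hl hl0
    simp only [Visits.iff_of_ne_zero hne, or_and_right, exists_or, exists_eq_left, hhead, htail,
      ih hl.2 hl0.2 hlt, List.exists_mem_cons_iff]

end Encodes

/-- The digits of a fact with count `m`, faces encoded by `code` and list of points `l`. -/
def factDigits (m : ℕ) (code : Fin d → Fin 4 → ℕ) (l : List ℕ) : List ℕ :=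
  m :: (List.ofFn (fun i : Fin (d * 4) => code i.divNat i.modNat) ++ l)

section factDigits

variable {m : ℕ} {code : Fin d → Fin 4 → ℕ} {l : List ℕ}

theorem factDigits_getD (j : Fin d) (t : Fin 4) :
    (factDigits m code l).getD (4 * j + t + 1) 0 = code j t := by
  have hlt : 4 * (j : ℕ) + t < d * 4 := by omega
  have hdiv : (⟨4 * j + t, hlt⟩ : Fin (d * 4)).divNat = j := Fin.ext (by simp; omega)
  have hmod : (⟨4 * j + t, hlt⟩ : Fin (d * 4)).modNat = t := Fin.ext (by simp)
  rw [factDigits, List.getD_cons_succ, List.getD_append _ _ _ _ (by simpa using hlt),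
    List.getD_eq_getElem _ _ (by simpa using hlt), List.getElem_ofFn, hdiv, hmod]

theorem factDigits_drop : (factDigits m code l).drop (4 * d + 1) = l := by
  rw [factDigits, List.drop_succ_cons, List.drop_left' (by simp [mul_comm])]

theorem factDigits_lt {N : ℕ} (hm : m < N) (hcode : ∀ j t, code j t < N) (hl : ∀ a ∈ l, a < N) :
    ∀ a ∈ factDigits m code l, a < N := by
  rw [factDigits, List.forall_mem_cons, List.forall_mem_append]
  exact ⟨hm, List.forall_mem_ofFn_iff.2 fun i => hcode _ _, hl⟩

theorem Encodes.read_factDigits {T : Tables d} {n V : ℕ} (h : T.Encodes n V)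
    (hlt : ∀ a ∈ factDigits m code l, a < n + 3) (hl0 : ∀ a ∈ l, a ≠ 0)
    (hV : Nat.ofDigits (n + 3) (factDigits m code l) < V) :
    T.read (Nat.ofDigits (n + 3) (factDigits m code l)) =
      ⟨m, ⟨fun j => T.point (code j 0) j + T.shift (code j 1),
        fun j => T.point (code j 2) j + T.shift (code j 3)⟩, {p | ∃ a ∈ l, a - 1 = p}⟩ := by
  have hcode : ∀ (j : Fin d) (t : Fin 4),
      T.digit (4 * j + t + 1) (Nat.ofDigits (n + 3) (factDigits m code l)) = code j t :=
    fun j t => by rw [h.digit_ofDigits hlt hV, factDigits_getD]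
  obtain ⟨htail, hVl⟩ := h.iterate_tail hlt hV (4 * d + 1)
  rw [factDigits_drop] at htail hVl
  have hll : ∀ a ∈ l, a < n + 3 := fun a ha =>
    hlt a (List.mem_cons_of_mem _ (List.mem_append_right _ ha))
  simp only [read, face, htail]
  congr
  · simpa [factDigits] using h.digit_ofDigits hlt hV 0
  · funext j
    rw [show 4 * (j : ℕ) + 1 = 4 * j + (0 : Fin 4) + 1 from rfl, hcode,
      show 4 * (j : ℕ) + (0 : Fin 4) + 1 + 1 = 4 * j + (1 : Fin 4) + 1 from rfl, hcode]
  · funext j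
    rw [show 4 * (j : ℕ) + 3 = 4 * j + (2 : Fin 4) + 1 from rfl, hcode,
      show 4 * (j : ℕ) + (2 : Fin 4) + 1 + 1 = 4 * j + (3 : Fin 4) + 1 from rfl, hcode]
  · exact funext fun p => propext (h.exists_visits_iff hll hl0 hVl (· - 1 = p))

end factDigits

theorem Encodes.exists_of_mem_sides {T : Tables d} {n V : ℕ} (h : T.Encodes n V) {j : Fin d}
    {t : ℝ} (ht : t ∈ sides T.point (Finset.range n) j) :
    ∃ a < n + 3, ∃ b < n + 3, T.point a j + T.shift b = t := by
  obtain ⟨p, hp, σ, hσ, rfl⟩ := ht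
  rw [Finset.mem_range] at hp
  refine ⟨p, by omega, ?_⟩
  rcases hσ with rfl | rfl | rfl
  · exact ⟨0, by omega, by rw [h.shift_zero]⟩
  · exact ⟨1, by omega, by rw [h.shift_one]⟩
  · exact ⟨2, by omega, by rw [h.shift_two]⟩

theorem Encodes.exists_read_eq {T : Tables d} {n M : ℕ}
    (h : T.Encodes n ((n + 3) ^ (4 * d + 1 + M))) {φ : Fact ℕ d}
    (hφ : φ ∈ facts T.point (Finset.range n) M) :
    ∃ f, 1 ≤ f ∧ f < (n + 3) ^ (4 * d + 1 + M) ∧ T.read f = φ := by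
  obtain ⟨hpos, hcount, hsides, F, hFU, hFM, hF⟩ := hφ
  rw [Finset.card_range] at hcount
  choose a ha b hb hlo using fun j => h.exists_of_mem_sides (hsides j).1
  choose a' ha' b' hb' hhi using fun j => h.exists_of_mem_sides (hsides j).2
  set code : Fin d → Fin 4 → ℕ := fun j => ![a j, b j, a' j, b' j]
  set l : List ℕ := F.toList.map (· + 1)
  have hcode : ∀ j t, code j t < n + 3 := by
    intro j t
    fin_cases t <;> simp [code, ha, hb, ha', hb']
  have hl : ∀ c ∈ l, c < n + 3 := by
    simp only [l, List.forall_mem_map, Finset.mem_toList]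
    intro p hp
    have := Finset.mem_range.1 (hFU hp)
    omega
  have hlt := factDigits_lt (by omega : φ.count < n + 3) hcode hl
  have hV : Nat.ofDigits (n + 3) (factDigits φ.count code l) < (n + 3) ^ (4 * d + 1 + M) :=
    (Nat.ofDigits_lt_base_pow_length (by omega) hlt).trans_le
      (Nat.pow_le_pow_right (by omega) (by simp [factDigits, l]; omega))
  refine ⟨_, ?_, hV, (h.read_factDigits hlt (by simp [l]) hV).trans ?_⟩
  · rw [factDigits, Nat.ofDigits_cons]
    omega
  · have hpoints : {p | ∃ c ∈ l, c - 1 = p} = φ.points := by ext; simp [l, hF]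
    simp [code, hlo, hhi, hpoints]

end Tables

end Packing

/-! ### Derivability as a formula -/

namespace RealRAM

variable {D : ℕ} {s : Memory}

/-- The expression that follows `i` links of `tailArray`. -/
def NExpr.tails (i : ℕ) (e : NExpr) : NExpr := (NExpr.load tailArray)^[i] e

theorem NExpr.tails_eval (s : Memory) (i : ℕ) (e : NExpr) :
    (NExpr.tails i e).eval s = (s.nat tailArray)^[i] (e.eval s) := by
  induction i with
  | zero => rfl
  | succ i ih => rw [tails, Function.iterate_succ_apply', Function.iterate_succ_apply', ← ih]; rfl

theorem NExpr.below_tails (hD : tailArray < D) {i : ℕ} {e : NExpr} :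
    (NExpr.tails i e).Below D ↔ e.Below D := by
  induction i with
  | zero => rfl
  | succ i ih => rw [tails, Function.iterate_succ_apply', ← ih]; simp [Below, hD, tails]

theorem NExpr.below_var {a : ℕ} (ha : resultReg < a) (haD : a < D) : (NExpr.var a).Below D :=
  ⟨haD, ha.ne', trivial⟩

namespace Test

/-- Disjunction. -/
def or (b c : Test) : Test := .not (.and (.not b) (.not c))

/-- Conjunction of finitely many tests. -/
def all {m : ℕ} (b : Fin m → Test) : Test := (List.ofFn b).foldr .and (.natEq (.lit 0) (.lit 0))

/-- Disjunction of finitely many tests. -/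
def any {m : ℕ} (b : Fin m → Test) : Test := .not (.all fun j => .not (b j))

variable {b c : Test} {m : ℕ} {f : Fin m → Test}

@[simp] theorem holds_or : (or b c).Holds s ↔ b.Holds s ∨ c.Holds s := by
  simp [or, Holds, or_iff_not_imp_left]

@[simp] theorem holds_all : (all f).Holds s ↔ ∀ j, (f j).Holds s := by
  rw [all, ← List.forall_mem_ofFn_iff]
  induction List.ofFn f with
  | nil => simp [Holds]
  | cons b l ih => simp [Holds, ih]

@[simp] theorem holds_any : (any f).Holds s ↔ ∃ j, (f j).Holds s := by
  simp [any, Holds]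

@[simp] theorem below_or : (or b c).Below D ↔ b.Below D ∧ c.Below D := Iff.rfl

@[simp] theorem below_all : (all f).Below D ↔ ∀ j, (f j).Below D := by
  rw [all, ← List.forall_mem_ofFn_iff]
  induction List.ofFn f with
  | nil => simp [Below, NExpr.Below]
  | cons b l ih => simp [Below, ih]

@[simp] theorem below_any : (any f).Below D ↔ ∀ j, (f j).Below D := by
  simp [any, Below]

end Test

namespace Formula

/-- Disjunction. -/
def or (φ ψ : Formula) : Formula := .not (.and (.not φ) (.not ψ))

/-- Implication. -/
def imp (φ ψ : Formula) : Formula := .not (.and φ (.not ψ))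

/-- Existential quantification. -/
def ex (τ : Traversal) (e : NExpr) (φ : Formula) : Formula := .not (.all τ e (.not φ))

variable {φ ψ : Formula} {τ : Traversal} {e : NExpr}

@[simp] theorem holds_or : (or φ ψ).Holds D s ↔ φ.Holds D s ∨ ψ.Holds D s := by
  simp [or, Holds, or_iff_not_imp_left]

@[simp] theorem holds_imp : (imp φ ψ).Holds D s ↔ (φ.Holds D s → ψ.Holds D s) := by
  simp [imp, Holds]

@[simp] theorem holds_ex : (ex τ e φ).Holds D s ↔
    ∃ w, Visits (τ.next s) (e.eval s) w ∧ φ.Holds (D + 1) (s.setNat D 0 w) := by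
  simp [ex, Holds]

end Formula

end RealRAM

namespace Packing

open RealRAM

/-- A conflict relation between points that is tested by the machine, holds only between points at
distance at most `2` and holds between any two points at distance at most `1 / resolution`, both in
the maximum norm. -/
structure Conflict (d : ℕ) where
  rel : (Fin d → ℝ) → (Fin d → ℝ) → Prop
  test : NExpr → NExpr → Test
  resolution : ℕ
  holds_test : ∀ s e f, (test e f).Holds s ↔
    rel (fun j => s.real j (e.eval s)) (fun j => s.real j (f.eval s))
  below_test : ∀ D e f, e.Below D → f.Below D → (test e f).Below D
  symm : ∀ y z, rel y z → rel z y
  close : ∀ y z, rel y z → ∀ j, |y j - z j| ≤ 2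
  of_close : ∀ y z, (∀ j, (resolution : ℝ) * |y j - z j| ≤ 1) → rel y z

/-- The tables kept in a memory: the points are in the real arrays below `d`, the shifts in the real
array `d`. -/
def tablesOf (d : ℕ) (s : Memory) : Tables d :=
  ⟨s.nat headArray, s.nat tailArray, fun p j => s.real j p, s.real d⟩

theorem tablesOf_setNat {d a : ℕ} (ha : 4 ≤ a) (s : Memory) (i v : ℕ) :
    tablesOf d (s.setNat a i v) = tablesOf d s := by
  rw [tablesOf, Memory.setNat_nat_of_ne _ _ _ (by omega), Memory.setNat_nat_of_ne _ _ _ (by omega)]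
  rfl

/-- The `i`-th digit of the number `f`. -/
def digitExpr (i : ℕ) (f : NExpr) : NExpr := .load headArray (.tails i f)

/-- The counterpart of `Tables.face`. -/
def faceExpr (d i : ℕ) (f : NExpr) (j : Fin d) : RExpr :=
  .add (.load j (digitExpr i f)) (.load d (digitExpr (i + 1) f))

/-- The list of points of the fact `f`. -/
def pointsExpr (d : ℕ) (f : NExpr) : NExpr := .tails (4 * d + 1) f

/-- The first point of the list `g`. -/
def memberExpr (g : NExpr) : NExpr := .sub (.load headArray g) (.lit 1)

/-- Whether the first point of the list `g` lies in the box of the fact `f`. -/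
def containsTest (d : ℕ) (f g : NExpr) : Test :=
  .all fun j : Fin d => .and (.realLE (faceExpr d (4 * j + 1) f j) (.load j (memberExpr g)))
    (.realLT (.load j (memberExpr g)) (faceExpr d (4 * j + 3) f j))

/-- Whether the first point of the list `g` is near the boundary of the box of the fact `f`. -/
def nearTest (d : ℕ) (f g : NExpr) : Test :=
  .any fun j : Fin d =>
    .or (.realLT (.load j (memberExpr g)) (.add (faceExpr d (4 * j + 1) f j) (.lit 2)))
      (.realLE (.sub (faceExpr d (4 * j + 3) f j) (.lit 2)) (.load j (memberExpr g)))

/-- Whether the box of the fact `f` is contained in that of `f'`. -/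
def leTest (d : ℕ) (f f' : NExpr) : Test :=
  .and (.all fun j : Fin d => .realLE (faceExpr d (4 * j + 1) f' j) (faceExpr d (4 * j + 1) f j))
    (.all fun j : Fin d => .realLE (faceExpr d (4 * j + 3) f j) (faceExpr d (4 * j + 3) f' j))

section Evaluation

variable (d : ℕ) (s : Memory)

theorem digitExpr_eval (i : ℕ) (f : NExpr) :
    (digitExpr i f).eval s = (tablesOf d s).digit i (f.eval s) := by
  simp only [digitExpr, NExpr.eval, NExpr.tails_eval, Tables.digit, tablesOf]

theorem pointsExpr_eval (f : NExpr) :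
    (pointsExpr d f).eval s = (tablesOf d s).tail^[4 * d + 1] (f.eval s) :=
  NExpr.tails_eval s _ f

theorem memberExpr_eval (g : NExpr) :
    (memberExpr g).eval s = (tablesOf d s).head (g.eval s) - 1 := rfl

theorem faceExpr_eval (i : ℕ) (f : NExpr) (j : Fin d) :
    (faceExpr d i f j).eval s = (tablesOf d s).face i (f.eval s) j := by
  simp only [faceExpr, RExpr.eval, digitExpr_eval d, Tables.face]; rfl

theorem holds_containsTest (f g : NExpr) : (containsTest d f g).Holds s ↔
    ((tablesOf d s).read (f.eval s)).box.Contains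
      ((tablesOf d s).point ((memberExpr g).eval s)) := by
  simp only [containsTest, Test.holds_all, Test.Holds, faceExpr_eval]; rfl

theorem holds_nearTest (f g : NExpr) : (nearTest d f g).Holds s ↔
    ((tablesOf d s).read (f.eval s)).box.Near
      ((tablesOf d s).point ((memberExpr g).eval s)) := by
  simp only [nearTest, Test.holds_any, Test.holds_or, Test.Holds, faceExpr_eval, RExpr.eval,
    Rat.cast_ofNat]
  rfl

theorem holds_leTest (f f' : NExpr) : (leTest d f f').Holds s ↔
    ((tablesOf d s).read (f.eval s)).box ≤ ((tablesOf d s).read (f'.eval s)).box := by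
  simp only [leTest, Test.holds_all, Test.Holds, faceExpr_eval]; rfl

end Evaluation

section Below

variable {d D i : ℕ} {f f' g : NExpr} {j : Fin d}

theorem below_digitExpr (hD : tailArray < D) : (digitExpr i f).Below D ↔ f.Below D := by
  simp [digitExpr, NExpr.Below, NExpr.below_tails hD, (by omega : headArray < D)]

theorem below_faceExpr (hD : tailArray < D) : (faceExpr d i f j).Below D ↔ f.Below D := by
  simp [faceExpr, RExpr.Below, below_digitExpr hD]

theorem below_memberExpr (hD : tailArray < D) : (memberExpr g).Below D ↔ g.Below D := by
  simp [memberExpr, NExpr.Below, (by omega : headArray < D)]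

theorem below_containsTest (hD : tailArray < D) (hf : f.Below D) (hg : g.Below D) :
    (containsTest d f g).Below D := by
  simp [containsTest, Test.Below, RExpr.Below, below_faceExpr hD, below_memberExpr hD, hf, hg]

theorem below_nearTest (hD : tailArray < D) (hf : f.Below D) (hg : g.Below D) :
    (nearTest d f g).Below D := by
  simp [nearTest, Test.Below, RExpr.Below, below_faceExpr hD, below_memberExpr hD, hf, hg]

theorem below_leTest (hD : tailArray < D) (hf : f.Below D) (hf' : f'.Below D) :
    (leTest d f f').Below D := by
  simp [leTest, Test.Below, below_faceExpr hD, hf, hf']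

end Below

/-- The counterpart of `Fact.IsBase` for the fact in `factVar`. -/
def baseFormula (d : ℕ) : Formula :=
  .and (.test (.natEq (digitExpr 0 (.var factVar)) (.lit 1))) <|
    .ex .links (pointsExpr d (.var factVar)) <| .test <|
      .and (.not (.natLE (.load inputArray (.lit 0)) (memberExpr (.var leftVar))))
        (containsTest d (.var factVar) (.var leftVar))

/-- The counterpart of the conditions `keeps_left` and `keeps_right` of `Fact.Joins`, for the facts
in the variable `a` and in `factVar`. -/
def keepsFormula (d a : ℕ) : Formula :=
  .all .links (pointsExpr d (.var a)) <|
    .imp (.test (nearTest d (.var factVar) (.var pointVar))) <|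
      .ex .links (pointsExpr d (.var factVar)) <|
        .test (.natEq (memberExpr (.var otherVar)) (memberExpr (.var pointVar)))

/-- The counterpart of the conditions of `Fact.Joins` on counts and boxes. -/
def splitTest (d : ℕ) : Test :=
  .and (.natEq (digitExpr 0 (.var factVar))
      (.add (digitExpr 0 (.var leftVar)) (digitExpr 0 (.var rightVar)))) <|
    .and (.any fun j : Fin d => .realLE (faceExpr d (4 * j + 3) (.var leftVar) j)
      (faceExpr d (4 * j + 1) (.var rightVar) j)) <|
    .and (leTest d (.var leftVar) (.var factVar)) (leTest d (.var rightVar) (.var factVar))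

/-- The counterpart of the condition `not_conflict` of `Fact.Joins`. -/
def notConflictFormula {d : ℕ} (R : Conflict d) : Formula :=
  .all .links (pointsExpr d (.var leftVar)) <| .all .links (pointsExpr d (.var rightVar)) <|
    .test (.not (R.test (memberExpr (.var pointVar)) (memberExpr (.var otherVar))))

/-- The counterpart of `Fact.Joins`. -/
def joinsFormula {d : ℕ} (R : Conflict d) : Formula :=
  .and (.test (splitTest d)) <|
    .and (notConflictFormula R) <| .and (keepsFormula d leftVar) (keepsFormula d rightVar)

/-- Whether the fact in `factVar` is a base fact or is joined from two marked facts. -/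
def deriveFormula {d : ℕ} (R : Conflict d) : Formula :=
  .or (baseFormula d) <|
    .ex .countdown (.var boundVar) <|
      .and (.test (.natEq (.load markArray (.var leftVar)) (.lit 1))) <|
        .ex .countdown (.var boundVar) <|
          .and (.test (.natEq (.load markArray (.var rightVar)) (.lit 1))) (joinsFormula R)

/-- Whether some marked fact has the count asked for. -/
def answerFormula : Formula :=
  .ex .countdown (.var boundVar) <| .test <|
    .and (.natEq (.load markArray (.var leftVar)) (.lit 1))
      (.natEq (digitExpr 0 (.var leftVar)) (.load inputArray (.lit 1)))

/-- The facts with a mark, among the numbers from `1` to `V`. -/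
def markedFacts (V : ℕ) (s : Memory) : Set ℕ := {f | 1 ≤ f ∧ f ≤ V ∧ s.nat markArray f = 1}

section Truth

variable {d : ℕ} (R : Conflict d) (s : Memory)

theorem next_links (d : ℕ) : (fun v => Traversal.links.next s v) = (tablesOf d s).tail := rfl

theorem next_countdown : (fun v => Traversal.countdown.next s v) = fun i => i - 1 := rfl

theorem holds_baseFormula : (baseFormula d).Holds 8 s ↔
    ((tablesOf d s).read (s.nat factVar 0)).IsBase (tablesOf d s).point
      (Finset.range (s.nat inputArray 0)) := by
  simp [-Function.iterate_succ, baseFormula, Formula.Holds, Test.Holds, holds_containsTest,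
    digitExpr_eval d, pointsExpr_eval, memberExpr_eval d, next_links s d, NExpr.eval,
    Memory.setNat_nat, tablesOf_setNat, Fact.IsBase, Tables.read]

theorem holds_keepsFormula {a : ℕ} : (keepsFormula d a).Holds 10 s ↔
    ∀ p ∈ ((tablesOf d s).read (s.nat a 0)).points,
      ((tablesOf d s).read (s.nat factVar 0)).box.Near ((tablesOf d s).point p) →
        p ∈ ((tablesOf d s).read (s.nat factVar 0)).points := by
  simp [-Function.iterate_succ, keepsFormula, Formula.Holds, Test.Holds, holds_nearTest,
    pointsExpr_eval, memberExpr_eval d, next_links _ d, NExpr.eval, Memory.setNat_nat,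
    tablesOf_setNat, Tables.read]

theorem holds_splitTest : (splitTest d).Holds s ↔
    ((tablesOf d s).read (s.nat factVar 0)).count =
        ((tablesOf d s).read (s.nat leftVar 0)).count +
          ((tablesOf d s).read (s.nat rightVar 0)).count ∧
      (∃ j, ((tablesOf d s).read (s.nat leftVar 0)).box.hi j ≤
        ((tablesOf d s).read (s.nat rightVar 0)).box.lo j) ∧
      ((tablesOf d s).read (s.nat leftVar 0)).box ≤
        ((tablesOf d s).read (s.nat factVar 0)).box ∧
      ((tablesOf d s).read (s.nat rightVar 0)).box ≤
        ((tablesOf d s).read (s.nat factVar 0)).box := by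
  simp only [splitTest, Test.Holds, Test.holds_any, holds_leTest, digitExpr_eval d, faceExpr_eval,
    NExpr.eval]
  rfl

theorem holds_notConflictFormula : (notConflictFormula R).Holds 10 s ↔
    ∀ p ∈ ((tablesOf d s).read (s.nat leftVar 0)).points,
      ∀ q ∈ ((tablesOf d s).read (s.nat rightVar 0)).points,
        ¬ R.rel ((tablesOf d s).point p) ((tablesOf d s).point q) := by
  simp [-Function.iterate_succ, notConflictFormula, Formula.Holds, Test.Holds, R.holds_test,
    pointsExpr_eval, memberExpr_eval d, next_links _ d, NExpr.eval, Memory.setNat_nat,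
    tablesOf_setNat, Tables.read]
  rfl

theorem holds_joinsFormula : (joinsFormula R).Holds 10 s ↔
    Fact.Joins (tablesOf d s).point R.rel ((tablesOf d s).read (s.nat leftVar 0))
      ((tablesOf d s).read (s.nat rightVar 0)) ((tablesOf d s).read (s.nat factVar 0)) := by
  simp only [joinsFormula, Formula.Holds, holds_notConflictFormula, holds_keepsFormula,
    holds_splitTest, and_assoc]
  exact ⟨fun ⟨h₁, h₂, h₃, h₄, h₅, h₆, h₇⟩ => ⟨h₁, h₂, h₃, h₄, h₅, h₆, h₇⟩,
    fun ⟨h₁, h₂, h₃, h₄, h₅, h₆, h₇⟩ => ⟨h₁, h₂, h₃, h₄, h₅, h₆, h₇⟩⟩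

theorem holds_deriveFormula : (deriveFormula R).Holds 8 s ↔
    ((tablesOf d s).read (s.nat factVar 0)).IsBase (tablesOf d s).point
        (Finset.range (s.nat inputArray 0)) ∨
      ∃ f₁ ∈ markedFacts (s.nat boundVar 0) s, ∃ f₂ ∈ markedFacts (s.nat boundVar 0) s,
        Fact.Joins (tablesOf d s).point R.rel ((tablesOf d s).read f₁) ((tablesOf d s).read f₂)
          ((tablesOf d s).read (s.nat factVar 0)) := by
  simp [deriveFormula, holds_baseFormula, Formula.Holds, holds_joinsFormula, next_countdown,
    Visits.pred_iff, Test.Holds, NExpr.eval, Memory.setNat_nat, tablesOf_setNat, markedFacts,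
    and_assoc]

theorem holds_answerFormula (d : ℕ) : answerFormula.Holds 8 s ↔
    ∃ f ∈ markedFacts (s.nat boundVar 0) s,
      ((tablesOf d s).read f).count = s.nat inputArray 1 := by
  simp [answerFormula, Formula.Holds, next_countdown, Visits.pred_iff, Test.Holds,
    digitExpr_eval d, tablesOf_setNat, NExpr.eval, Memory.setNat_nat, markedFacts, Tables.read,
    and_assoc]

theorem below_deriveFormula : (deriveFormula R).Below 8 := by
  simp [deriveFormula, baseFormula, joinsFormula, notConflictFormula, keepsFormula, splitTest,
    Formula.or, Formula.ex, Formula.imp, Formula.Below, Test.Below, NExpr.Below, pointsExpr,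
    NExpr.below_tails, below_digitExpr, below_faceExpr, below_memberExpr, R.below_test,
    below_containsTest, below_nearTest, below_leTest, ↓NExpr.below_var]

theorem below_answerFormula : answerFormula.Below 8 := by
  simp [answerFormula, Formula.ex, Formula.Below, Test.Below, NExpr.Below, below_digitExpr]

theorem bounded_deriveFormula {s : Memory} (hlinks : ∀ v, s.nat tailArray v ≤ v)
    (hfact : s.nat factVar 0 ≤ s.nat boundVar 0) :
    (deriveFormula R).Bounded (s.nat boundVar 0) 8 s := by
  have hiter : ∀ {v i : ℕ}, v ≤ s.nat boundVar 0 → (s.nat tailArray)^[i] v ≤ s.nat boundVar 0 :=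
    fun h => (Function.iterate_le_id_of_le_id hlinks _ _).trans h
  simp only [deriveFormula, baseFormula, joinsFormula, notConflictFormula, keepsFormula,
    Formula.or, Formula.imp, Formula.ex, Formula.Bounded, pointsExpr, NExpr.tails_eval, NExpr.eval,
    Memory.setNat_nat]
  simp +contextual [-Function.iterate_succ, Memory.setNat_nat_of_ne, hiter, hfact]

theorem bounded_answerFormula : answerFormula.Bounded (s.nat boundVar 0) 8 s := by
  simp [answerFormula, Formula.ex, Formula.Bounded, NExpr.eval]

end Truth

end Packing

/-! ### The tables -/

attribute [ext] RealRAM.Memory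

namespace RealRAM

/-- The real scalar variable `a`, which lives in cell `0` of the real array `a`. -/
abbrev RExpr.var (a : ℕ) : RExpr := .load a (.lit 0)

/-- The `m`-th power of an expression, by repeated multiplication. -/
def RExpr.pow (e : RExpr) : ℕ → RExpr
  | 0 => .lit 1
  | m + 1 => .mul (e.pow m) e

theorem RExpr.pow_eval (s : Memory) (e : RExpr) (m : ℕ) : (e.pow m).eval s = e.eval s ^ m := by
  induction m with
  | zero => simp [pow, eval]
  | succ m ih => rw [pow, eval, ih, pow_succ]

/-- Assignment to a natural number variable. -/
abbrev Program.assignNat (a : ℕ) (e : NExpr) : Program := .natStore a (.lit 0) e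

/-- Assignment to a real variable. -/
abbrev Program.assignReal (a : ℕ) (e : RExpr) : Program := .realStore a (.lit 0) e

end RealRAM

namespace Packing

open RealRAM

section Count

/-- Whether the counter is below cell `i` of the input array. -/
def countTest (i : ℕ) : Test := .not (.natLE (.load inputArray (.lit i)) (.var counterVar))

/-- Adds cell `i` of the input array to the real variable `r`. -/
def countProgram (i r : ℕ) : Program :=
  .seq (.assignNat counterVar (.lit 0)) <|
    .loop (countTest i) <|
      .seq (.assignNat counterVar (.add (.var counterVar) (.lit 1)))
        (.assignReal r (.add (.var r) (.lit 1)))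

theorem exists_halts_countProgram (i r : ℕ) : ∃ T, PolyBounded T ∧ ∀ {V : ℕ} {s : Memory},
    s.nat inputArray i ≤ V → HaltsWithin (countProgram i r) s (T V)
      (· = (s.setNat counterVar 0 (s.nat inputArray i)).setReal r 0
        (s.real r 0 + s.nat inputArray i)) := by
  let mem (s : Memory) (m : ℕ) := (s.setNat counterVar 0 m).setReal r 0 (s.real r 0 + m)
  obtain ⟨T, hT⟩ : ∃ T, ∀ s m, HaltsWithin (.seq
      (.assignNat counterVar (.add (.var counterVar) (.lit 1)))
      (.assignReal r (.add (.var r) (.lit 1)))) (mem s m) T (· = mem s (m + 1)) := by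
    refine ⟨_, fun s m => .seq_of_eq (.natStore rfl) (.realStore ?_)⟩
    simp [mem, NExpr.eval, RExpr.eval, Memory.setNat, Memory.setReal, add_assoc]
  have hzero (s : Memory) : mem s 0 = s.setNat counterVar 0 0 := by simp [mem, Memory.setReal]; rfl
  have htest (s : Memory) (m : ℕ) : (countTest i).Holds (mem s m) ↔ m < s.nat inputArray i := by
    simp [mem, countTest, Test.Holds, NExpr.eval, Memory.setNat_nat]
  exact ⟨_, (PolyBounded.const _).add ((PolyBounded.const T).loop (countTest i)), fun {V s} hV =>
    .seq_of_eq (.natStore (hzero s).symm) (.loop_of_eq hV (htest s) (hT s))⟩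

end Count

section Length

/-- The bound for the lists of points in facts. -/
noncomputable def listLength (d C k : ℕ) : ℕ := ⌈(C : ℝ) * (k : ℝ) ^ (1 - 1 / (d : ℝ))⌉₊

/-- Whether the number `m` in the length register is below `C * k ^ (1 - 1 / d)`, tested in the form
`m ^ d < C ^ d * k ^ (d - 1)`. -/
def lengthTest (d C : ℕ) : Test :=
  .realLT (.pow (.var (lengthReg d)) d)
    (.mul (.lit ((C : ℚ) ^ d)) (.pow (.var (countReg d)) (d - 1)))

/-- Counts the length register up to `listLength d C k` and multiplies the number register by the
base as often. -/
def lengthProgram (d C : ℕ) : Program :=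
  .loop (lengthTest d C) <|
    .seq (.assignReal (lengthReg d) (.add (.var (lengthReg d)) (.lit 1)))
      (.assignReal (numberReg d) (.mul (.var (numberReg d)) (.var (baseReg d))))

variable {d C k m : ℕ} {s : Memory}

theorem holds_lengthTest (hd : 0 < d) (hk : s.real (countReg d) 0 = k)
    (hm : s.real (lengthReg d) 0 = m) : (lengthTest d C).Holds s ↔ m < listLength d C k := by
  have hpow : ((C : ℝ) * (k : ℝ) ^ (1 - 1 / (d : ℝ))) ^ d = (C : ℝ) ^ d * (k : ℝ) ^ (d - 1) := by
    rw [mul_pow, ← rpow_one_div_pow_pred (Nat.cast_nonneg k) hd, pow_right_comm,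
      one_div, Real.rpow_inv_natCast_pow (Nat.cast_nonneg k) hd.ne']
  rw [listLength, Nat.lt_ceil, ← pow_lt_pow_iff_left₀ (by positivity) (by positivity) hd.ne', hpow]
  simp [lengthTest, Test.Holds, RExpr.pow_eval, RExpr.eval, NExpr.eval, hk, hm]

theorem exists_halts_lengthProgram (hd : 0 < d) (C : ℕ) :
    ∃ T, PolyBounded T ∧ ∀ {V k : ℕ} {s : Memory}, s.real (countReg d) 0 = k →
      s.real (lengthReg d) 0 = 0 → listLength d C k ≤ V → HaltsWithin (lengthProgram d C) s (T V)
        (· = (s.setReal (lengthReg d) 0 (listLength d C k)).setReal (numberReg d) 0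
          (s.real (numberReg d) 0 * s.real (baseReg d) 0 ^ listLength d C k)) := by
  let mem (s : Memory) (m : ℕ) := (s.setReal (lengthReg d) 0 m).setReal (numberReg d) 0
    (s.real (numberReg d) 0 * s.real (baseReg d) 0 ^ m)
  obtain ⟨T, hT⟩ : ∃ T, ∀ s m, HaltsWithin (.seq
      (.assignReal (lengthReg d) (.add (.var (lengthReg d)) (.lit 1)))
      (.assignReal (numberReg d) (.mul (.var (numberReg d)) (.var (baseReg d)))))
      (mem s m) T (· = mem s (m + 1)) := by
    refine ⟨_, fun s m => .seq_of_eq (.realStore rfl) (.realStore ?_)⟩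
    simp [mem, NExpr.eval, RExpr.eval, Memory.setReal, pow_succ, mul_assoc,
      Function.update_comm (show lengthReg d ≠ numberReg d by omega)]
  refine ⟨_, (PolyBounded.const T).loop (lengthTest d C), fun {V k s} hk hzero hV => ?_⟩
  have htest (m : ℕ) : (lengthTest d C).Holds (mem s m) ↔ m < listLength d C k :=
    holds_lengthTest hd (by simpa [mem, Memory.setReal_real] using hk)
      (by simp [mem, Memory.setReal_real])
  have hzero : mem s 0 = s := by simp [mem, Memory.setReal, ← hzero]
  have hrun := HaltsWithin.loop_of_eq hV htest (hT s)
  rwa [hzero] at hrun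

end Length
section Table

theorem succ_div_mod_of_mod_add_one_eq {i N : ℕ} (h : i % N + 1 = N) :
    (i + 1) / N = i / N + 1 ∧ (i + 1) % N = 0 := by
  rw [Nat.div_mod_unique (by omega)]
  have := Nat.div_add_mod i N
  constructor
  · rw [mul_add]
    omega
  · omega

theorem succ_div_mod_of_mod_add_one_ne {i N : ℕ} (hN : 0 < N) (h : i % N + 1 ≠ N) :
    (i + 1) / N = i / N ∧ (i + 1) % N = i % N + 1 := by
  rw [Nat.div_mod_unique hN]
  have := Nat.div_add_mod i N
  have := Nat.mod_lt i hN
  omega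

/-- The memory `s` with the first `i` entries of the tables, and with `i` and its quotient and
remainder in the variables that drive the computation of the tables. -/
noncomputable def tableMemory (d : ℕ) (s : Memory) (i : ℕ) : Memory :=
  ({ s with nat := fun a g =>
      if a = headArray ∧ g < i then g % (s.nat inputArray 0 + 3)
      else if a = tailArray ∧ g < i then g / (s.nat inputArray 0 + 3) else s.nat a g }
    |>.setNat counterVar 0 i |>.setNat quotientVar 0 (i / (s.nat inputArray 0 + 3))
    |>.setNat remainderVar 0 (i % (s.nat inputArray 0 + 3))).setReal (filledReg d) 0 i

/-- Writes the next entry of the tables. -/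
def entryProgram : Program :=
  .seq (.natStore headArray (.var counterVar) (.var remainderVar))
    (.natStore tailArray (.var counterVar) (.var quotientVar))

/-- Increases the counter and its real copy, and updates the quotient and the remainder of its
division by the number of points plus three. -/
def advanceProgram (d : ℕ) : Program :=
  .seq (.assignNat counterVar (.add (.var counterVar) (.lit 1))) <|
    .seq (.assignReal (filledReg d) (.add (.var (filledReg d)) (.lit 1))) <|
      .branch (.natEq (.add (.var remainderVar) (.lit 1))
          (.add (.load inputArray (.lit 0)) (.lit 3)))
        (.seq (.assignNat remainderVar (.lit 0))
          (.assignNat quotientVar (.add (.var quotientVar) (.lit 1))))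
        (.assignNat remainderVar (.add (.var remainderVar) (.lit 1)))

/-- Whether there are entries of the tables left to write. -/
def tableTest (d : ℕ) : Test := .realLT (.var (filledReg d)) (.var (numberReg d))

/-- Writes the tables, with as many entries as the number register says. -/
def tableProgram (d : ℕ) : Program :=
  .seq (.assignNat counterVar (.lit 0)) <| .seq (.assignNat quotientVar (.lit 0)) <|
    .seq (.assignNat remainderVar (.lit 0)) <|
      .loop (tableTest d) (.seq entryProgram (advanceProgram d))

theorem exists_halts_tableStep (d : ℕ) : ∃ T, ∀ s i, HaltsWithin
    (.seq entryProgram (advanceProgram d)) (tableMemory d s i) T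
      (· = tableMemory d s (i + 1)) := by
  refine ⟨_, fun s i => .seq_of_eq (.seq_of_eq (.natStore rfl) (.natStore rfl)) <|
    .seq_of_eq (.natStore rfl) <| .seq_of_eq (.realStore rfl) <| .branch
      (fun h => (HaltsWithin.seq_of_eq (.natStore rfl) (.natStore ?_)).mono (le_max_left _ _)
        fun _ h => h)
      (fun h => (HaltsWithin.natStore ?_).mono (le_max_right _ _) fun _ h => h)⟩
  · obtain ⟨hdiv, hmod⟩ := succ_div_mod_of_mod_add_one_eq (i := i) (N := s.nat inputArray 0 + 3)
      (by simpa [tableMemory, Test.Holds, NExpr.eval, Memory.setNat_nat] using h)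
    clear h
    ext a g
    · simp only [tableMemory, Memory.setNat_nat, NExpr.eval, hdiv, hmod, Memory.setReal_nat]
      grind
    · simp only [tableMemory, Memory.setNat_real, Memory.setReal_real, NExpr.eval, RExpr.eval,
        Rat.cast_one, Nat.cast_add_one]
      grind
  · obtain ⟨hdiv, hmod⟩ := succ_div_mod_of_mod_add_one_ne (i := i) (N := s.nat inputArray 0 + 3)
      (by omega) (by simpa [tableMemory, Test.Holds, NExpr.eval, Memory.setNat_nat] using h)
    clear h
    ext a g
    · simp only [tableMemory, Memory.setNat_nat, NExpr.eval, hdiv, hmod, Memory.setReal_nat]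
      grind
    · simp only [tableMemory, Memory.setNat_real, Memory.setReal_real, NExpr.eval, RExpr.eval,
        Rat.cast_one, Nat.cast_add_one]
      grind

theorem exists_halts_tableProgram (d : ℕ) : ∃ T, PolyBounded T ∧ ∀ {V : ℕ} {s : Memory},
    s.real (numberReg d) 0 = V → s.real (filledReg d) 0 = 0 →
      HaltsWithin (tableProgram d) s (T V) (· = tableMemory d s V) := by
  obtain ⟨T, hT⟩ := exists_halts_tableStep d
  refine ⟨_, (PolyBounded.const _).add <| (PolyBounded.const _).add <| (PolyBounded.const _).add <|
    (PolyBounded.const T).loop (tableTest d), fun {V s} hV hfilled => .seq_of_eq (.natStore rfl) <|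
    .seq_of_eq (.natStore rfl) <| .seq_of_eq (.natStore ?_) <| .loop_of_eq le_rfl
      (fun i => ?_) (hT s)⟩
  · ext a g
    · simp only [tableMemory, Memory.setNat_nat, NExpr.eval, Memory.setReal_nat, Nat.zero_div,
        Nat.zero_mod]
      grind
    · simp only [tableMemory, Memory.setNat_real, Memory.setReal_real, Nat.cast_zero]
      grind
  · simp [tableTest, Test.Holds, tableMemory, RExpr.eval, NExpr.eval, Memory.setReal_real, hV]

end Table

section Preparation

variable {d n : ℕ}

/-- The memory `s` is ready for the rounds of marking: it holds the tables for the `V` numbers of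
facts about the given points, and no fact is marked. -/
structure Prepared (c : Fin n → EuclideanSpace ℝ (Fin d)) (k V : ℕ) (s : Memory) : Prop where
  size : s.nat inputArray 0 = n
  count : s.nat inputArray 1 = k
  bound : s.nat counterVar 0 = V
  unmarked : ∀ f, s.nat markArray f = 0
  point : ∀ p : Fin n, (tablesOf d s).point p = c p
  encodes : (tablesOf d s).Encodes n V
  tail_le : ∀ g, s.nat tailArray g ≤ g / (n + 3)

theorem Prepared.tail_lt {c : Fin n → EuclideanSpace ℝ (Fin d)} {k V : ℕ} {s : Memory}
    (hs : Prepared c k V s) {g : ℕ} (hg : g ≠ 0) : s.nat tailArray g < g :=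
  (hs.tail_le g).trans_lt (Nat.div_lt_self (by omega) (by omega))

theorem Prepared.tail_zero {c : Fin n → EuclideanSpace ℝ (Fin d)} {k V : ℕ} {s : Memory}
    (hs : Prepared c k V s) : s.nat tailArray 0 = 0 := by
  simpa using hs.tail_le 0

/-- The memory `s` is the input together with the shifts and with the number `V` of table entries in
the number register. -/
structure HasScalars (c : Fin n → EuclideanSpace ℝ (Fin d)) (k V : ℕ) (s : Memory) : Prop where
  nat_eq : ∀ a ≠ counterVar, s.nat a = (input c k).nat a
  real_eq : ∀ j < d, s.real j = (input c k).real j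
  shift_zero : s.real d 0 = 0
  shift_one : s.real d 1 = 3
  shift_two : s.real d 2 = -3
  number : s.real (numberReg d) 0 = V
  filled : s.real (filledReg d) 0 = 0

theorem HasScalars.prepared {c : Fin n → EuclideanSpace ℝ (Fin d)} {k V : ℕ} {s : Memory}
    (hs : HasScalars c k V s) : Prepared c k V (tableMemory d s V) := by
  have hne (j : Fin d) : (j : ℕ) ≠ filledReg d := by omega
  constructor
  case encodes =>
    constructor <;> simp +contextual [hs.nat_eq, hs.shift_zero, hs.shift_one, hs.shift_two, input,
      tablesOf, tableMemory, Memory.setNat_nat, Memory.setReal_real]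
  case tail_le =>
    intro g
    have htail : (tableMemory d s V).nat tailArray g = if g < V then g / (n + 3) else 0 := by
      simp [tableMemory, Memory.setNat_nat, hs.nat_eq, input]
    grind
  all_goals simp [hs.nat_eq, hs.real_eq, hne, input, tablesOf, tableMemory, Memory.setNat_nat,
    Memory.setReal_real]

/-- Computes the scalars of `HasScalars`. -/
def scalarProgram (d C : ℕ) : Program :=
  .seq (.realStore d (.lit 1) (.lit 3)) <| .seq (.realStore d (.lit 2) (.lit (-3))) <|
    .seq (countProgram 1 (countReg d)) <| .seq (.assignReal (baseReg d) (.lit 3)) <|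
      .seq (countProgram 0 (baseReg d)) <|
        .seq (.assignReal (numberReg d) (.pow (.var (baseReg d)) (4 * d + 1))) <|
          lengthProgram d C

theorem exists_halts_scalarProgram (hd : 0 < d) (C : ℕ) : ∃ T, PolyBounded T ∧
    ∀ {n k V : ℕ} (c : Fin n → EuclideanSpace ℝ (Fin d)), k ≤ n →
      V = (n + 3) ^ (4 * d + 1 + listLength d C k) →
        HaltsWithin (scalarProgram d C) (input c k) (T V) (HasScalars c k V) := by
  obtain ⟨T₁, hT₁, hcount⟩ := exists_halts_countProgram 1 (countReg d)
  obtain ⟨T₂, hT₂, hbase⟩ := exists_halts_countProgram 0 (baseReg d)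
  obtain ⟨T₃, hT₃, hlength⟩ := exists_halts_lengthProgram hd C
  have hle (n m : ℕ) : n ≤ (n + 3) ^ (4 * d + 1 + m) :=
    (Nat.le_add_right n 3).trans (Nat.le_self_pow (by omega) _)
  refine ⟨_, .add (.const _) <| .add (.const _) <| .add hT₁ <| .add (.const _) <| .add hT₂ <|
    .add (.const _) hT₃, fun {n k V} c hkn hV => .seq_of_eq (.realStore rfl) <|
    .seq_of_eq (.realStore rfl) <|
    .seq_of_eq (hcount ?_) <| .seq_of_eq (.realStore rfl) <| .seq_of_eq (hbase ?_) <|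
    .seq_of_eq (.realStore rfl) <| (hlength (k := k) ?_ ?_ ?_).mono le_rfl ?_⟩
  · simpa [input] using hkn.trans (hV ▸ hle n _)
  · simpa [input] using hV ▸ hle n _
  · simp [input, Memory.setReal_real, NExpr.eval, RExpr.eval]
  · simp [input, Memory.setReal_real, NExpr.eval, RExpr.eval]
  · exact hV ▸ (Nat.le_add_left _ _).trans (Nat.lt_pow_self (by omega)).le
  · rintro _ rfl
    constructor
    case number => simp [input, Memory.setReal_real, Memory.setNat_nat, RExpr.pow_eval, NExpr.eval,
      RExpr.eval, hV, pow_add, add_comm]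
    case real_eq =>
      intro j hj
      ext g
      have : j ≠ d ∧ j ≠ countReg d ∧ j ≠ baseReg d ∧ j ≠ lengthReg d ∧ j ≠ numberReg d := by omega
      simp [Memory.setReal_real, this]
    all_goals simp +contextual [funext_iff, input, Memory.setReal_real, Memory.setNat_nat,
      NExpr.eval, RExpr.eval]

/-- Computes the scalars and the tables. -/
def prepareProgram (d C : ℕ) : Program := .seq (scalarProgram d C) (tableProgram d)

theorem exists_halts_prepareProgram (hd : 0 < d) (C : ℕ) : ∃ T, PolyBounded T ∧
    ∀ {n k V : ℕ} (c : Fin n → EuclideanSpace ℝ (Fin d)), k ≤ n →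
      V = (n + 3) ^ (4 * d + 1 + listLength d C k) →
        HaltsWithin (prepareProgram d C) (input c k) (T V) (Prepared c k V) := by
  obtain ⟨T, hT, hscalars⟩ := exists_halts_scalarProgram hd C
  obtain ⟨T', hT', htable⟩ := exists_halts_tableProgram d
  exact ⟨_, hT.add hT', fun c hkn hV => (hscalars c hkn hV).seq fun s hs =>
    (htable hs.number hs.filled).mono le_rfl fun _ h => h ▸ hs.prepared⟩

end Preparation

end Packing

/-! ### Marking the derivable facts -/

namespace Packing

open RealRAM

variable {d n k V i : ℕ}

/-- Everything but marks and working variables is as in the memory `s`. -/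
structure SameTables (s s' : Memory) : Prop where
  real : s'.real = s.real
  nat : ∀ a ∈ [inputArray, headArray, tailArray, boundVar], s'.nat a = s.nat a

section SameTables

variable {s s' s'' : Memory}

theorem SameTables.refl (s : Memory) : SameTables s s := ⟨rfl, fun _ _ => rfl⟩

theorem SameTables.trans (h : SameTables s s') (h' : SameTables s' s'') : SameTables s s'' :=
  ⟨h'.real.trans h.real, fun a ha => (h'.nat a ha).trans (h.nat a ha)⟩

theorem SameTables.of_agree (h : Agree 8 s s') : SameTables s s' :=
  ⟨h.real, fun a ha => h.nat (by simp at ha; omega) (by simp at ha; omega)⟩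

theorem SameTables.setNat {a : ℕ} (ha : a ∉ [inputArray, headArray, tailArray, boundVar])
    (i v : ℕ) : SameTables s (s.setNat a i v) :=
  ⟨rfl, fun _ hb => Memory.setNat_nat_of_ne _ _ _ (ne_of_mem_of_not_mem hb ha)⟩

theorem SameTables.tablesOf_eq (h : SameTables s s') : tablesOf d s' = tablesOf d s := by
  simp [tablesOf, h.real, h.nat headArray, h.nat tailArray]

end SameTables

/-- Marks the fact in `factVar` if and only if it is a base fact or joined from marked facts, and
goes on to the next one. -/
def markProgram (R : Conflict d) : Program :=
  .seq ((deriveFormula R).compile 8) <|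
    .seq (.natStore markArray (.var factVar) (.var resultReg)) <|
      .assignNat factVar (.sub (.var factVar) (.lit 1))

/-- The effect of `markProgram`. -/
structure MarkStep (R : Conflict d) (s s' : Memory) : Prop where
  same : SameTables s s'
  round : s'.nat roundVar 0 = s.nat roundVar 0
  fact : s'.nat factVar 0 = s.nat factVar 0 - 1
  mark_of_ne : ∀ f ≠ s.nat factVar 0, s'.nat markArray f = s.nat markArray f
  mark_iff : s'.nat markArray (s.nat factVar 0) = 1 ↔ (deriveFormula R).Holds 8 s

theorem exists_halts_markProgram (R : Conflict d) : ∃ T, PolyBounded T ∧ ∀ {s : Memory},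
    (∀ v ≠ 0, s.nat tailArray v < v) → s.nat tailArray 0 = 0 →
      s.nat factVar 0 ≤ s.nat boundVar 0 →
        HaltsWithin (markProgram R) s (T (s.nat boundVar 0)) (MarkStep R s) := by
  refine ⟨_, (deriveFormula R).polyBounded_costBound.add (.add (.const _) (.const _)),
    fun {s} hlinks hzero hfact => ((deriveFormula R).evaluatedBy_compile (by norm_num)
      (below_deriveFormula R) hlinks (bounded_deriveFormula R (fun v => ?_) hfact) s
      (.refl 8 s)).seq fun s₁ ⟨hagree, hreports⟩ => .seq_of_eq (.natStore rfl) (.natStore ?_)⟩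
  · obtain rfl | hv := eq_or_ne v 0
    exacts [hzero.le, (hlinks v hv).le]
  · have hround : s₁.nat roundVar = s.nat roundVar := hagree.nat (by norm_num) (by norm_num)
    have hfact : s₁.nat factVar = s.nat factVar := hagree.nat (by norm_num) (by norm_num)
    have hmark : s₁.nat markArray = s.nat markArray := hagree.nat (by norm_num) (by norm_num)
    refine ⟨(SameTables.of_agree hagree).trans ((SameTables.setNat (by simp) _ _).trans
      (.setNat (by simp) _ _)), ?_, ?_, ?_, ?_⟩
    all_goals simp +contextual [NExpr.eval, Memory.setNat_nat, hround, hfact, hmark, hreports.iff]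

/-- The marks of the memory `s'` are as they should be after `i` rounds, started from `s`. -/
structure MarkInv (R : Conflict d) (n V : ℕ) (A : Set (Fact ℕ d)) (s : Memory) (i : ℕ)
    (s' : Memory) : Prop where
  same : SameTables s s'
  marked : ∀ f, 1 ≤ f → f ≤ V → ((tablesOf d s).read f).Derivable (tablesOf d s).point
    (Finset.range n) R.rel A i → f ∈ markedFacts V s'
  valid : ∀ f ∈ markedFacts V s',
    ((tablesOf d s).read f).Valid (tablesOf d s).point (Finset.range n) R.rel

/-- The memory `s'` during round `i + 1`, when the facts above `f₀` have been dealt with and `r`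
more rounds are to come. -/
structure SweepInv (R : Conflict d) (n V : ℕ) (A : Set (Fact ℕ d)) (s : Memory) (i r f₀ : ℕ)
    (s' : Memory) : Prop extends MarkInv R n V A s i s' where
  round : s'.nat roundVar 0 = r
  fact : s'.nat factVar 0 = f₀
  fact_le : f₀ ≤ V
  marked_succ : ∀ f, f₀ < f → f ≤ V → ((tablesOf d s).read f).Derivable (tablesOf d s).point
    (Finset.range n) R.rel A (i + 1) → f ∈ markedFacts V s'

section Marking

variable {R : Conflict d} {A : Set (Fact ℕ d)} {c : Fin n → EuclideanSpace ℝ (Fin d)}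
  {s s' s'' : Memory}

theorem Prepared.holds_deriveFormula_iff (hs : Prepared c k V s) (hsame : SameTables s s') :
    (deriveFormula R).Holds 8 s' ↔
      ((tablesOf d s).read (s'.nat factVar 0)).IsBase (tablesOf d s).point (Finset.range n) ∨
        ∃ f₁ ∈ markedFacts V s', ∃ f₂ ∈ markedFacts V s', Fact.Joins (tablesOf d s).point R.rel
          ((tablesOf d s).read f₁) ((tablesOf d s).read f₂)
          ((tablesOf d s).read (s'.nat factVar 0)) := by
  rw [holds_deriveFormula, hsame.tablesOf_eq, hsame.nat inputArray (by simp),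
    hsame.nat boundVar (by simp), hs.size, hs.bound]

theorem MarkInv.holds_of_derivable (hs : Prepared c k V s)
    (hA : ∀ φ ∈ A, ∃ f, 1 ≤ f ∧ f < V ∧ (tablesOf d s).read f = φ) (h : MarkInv R n V A s i s')
    (hder : ((tablesOf d s).read (s'.nat factVar 0)).Derivable (tablesOf d s).point
      (Finset.range n) R.rel A (i + 1)) : (deriveFormula R).Holds 8 s' := by
  rw [hs.holds_deriveFormula_iff h.same]
  cases hder with
  | base _ hbase => exact .inl hbase
  | join _ h₁ h₂ hjoin =>
    obtain ⟨f₁, hf₁, hV₁, rfl⟩ := hA _ h₁.mem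
    obtain ⟨f₂, hf₂, hV₂, rfl⟩ := hA _ h₂.mem
    exact .inr ⟨f₁, h.marked f₁ hf₁ hV₁.le h₁, f₂, h.marked f₂ hf₂ hV₂.le h₂, hjoin⟩

theorem MarkInv.valid_of_holds (hs : Prepared c k V s) (h : MarkInv R n V A s i s')
    (hholds : (deriveFormula R).Holds 8 s') :
    ((tablesOf d s).read (s'.nat factVar 0)).Valid (tablesOf d s).point (Finset.range n)
      R.rel := by
  rcases (hs.holds_deriveFormula_iff h.same).1 hholds with hbase | ⟨f₁, hf₁, f₂, hf₂, hjoin⟩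
  · exact hbase.valid
  · exact hjoin.valid R.symm R.close (h.valid f₁ hf₁) (h.valid f₂ hf₂)

theorem SweepInv.step (hs : Prepared c k V s)
    (hA : ∀ φ ∈ A, ∃ f, 1 ≤ f ∧ f < V ∧ (tablesOf d s).read f = φ) {r f₀ : ℕ} (hf₀ : f₀ ≠ 0)
    (h : SweepInv R n V A s i r f₀ s') (hstep : MarkStep R s' s'') :
    SweepInv R n V A s i r (f₀ - 1) s'' := by
  obtain rfl := h.fact
  have hmem {f : ℕ} (hf : f ≠ s'.nat factVar 0) :
      f ∈ markedFacts V s'' ↔ f ∈ markedFacts V s' := by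
    simp [markedFacts, hstep.mark_of_ne f hf]
  have hmem_self : s'.nat factVar 0 ∈ markedFacts V s'' ↔ (deriveFormula R).Holds 8 s' := by
    simp [markedFacts, hstep.mark_iff, h.fact_le, Nat.one_le_iff_ne_zero, hf₀]
  refine ⟨⟨h.same.trans hstep.same, fun f hf hfV hder => ?_, fun f hf => ?_⟩,
    hstep.round.trans h.round, hstep.fact, (Nat.sub_le _ _).trans h.fact_le,
    fun f hf hfV hder => ?_⟩
  · obtain rfl | hne := eq_or_ne f (s'.nat factVar 0)
    · exact hmem_self.2 (h.holds_of_derivable hs hA (hder.mono i.le_succ))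
    · exact (hmem hne).2 (h.marked f hf hfV hder)
  · obtain rfl | hne := eq_or_ne f (s'.nat factVar 0)
    · exact h.valid_of_holds hs (hmem_self.1 hf)
    · exact h.valid f ((hmem hne).1 hf)
  · obtain rfl | hne := eq_or_ne f (s'.nat factVar 0)
    · exact hmem_self.2 (h.holds_of_derivable hs hA hder)
    · exact (hmem hne).2 (h.marked_succ f (by omega) hfV hder)

theorem SweepInv.markInv_succ {r : ℕ} (h : SweepInv R n V A s i r 0 s') :
    MarkInv R n V A s (i + 1) s' :=
  ⟨h.same, fun f hf => h.marked_succ f hf, h.valid⟩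

/-- Runs `markProgram` on all facts, starting from the last one, and counts down the rounds. -/
def roundProgram (R : Conflict d) : Program :=
  .seq (.assignNat factVar (.var boundVar)) <|
    .seq (.loop (.not (.natEq (.var factVar) (.lit 0))) (markProgram R))
      (.assignNat roundVar (.sub (.var roundVar) (.lit 1)))

/-- Runs as many rounds as the count asked for says. -/
def roundsProgram (R : Conflict d) : Program :=
  .seq (.assignNat roundVar (.load inputArray (.lit 1))) <|
    .loop (.not (.natEq (.var roundVar) (.lit 0))) (roundProgram R)

theorem MarkInv.setNat (h : MarkInv R n V A s i s') {a : ℕ}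
    (ha : a ∉ [inputArray, headArray, tailArray, markArray, boundVar]) (j v : ℕ) :
    MarkInv R n V A s i (s'.setNat a j v) := by
  have hmarked : markedFacts V (s'.setNat a j v) = markedFacts V s' := by
    simp only [markedFacts, Memory.setNat_nat_of_ne _ _ _ (by grind : markArray ≠ a)]
  exact ⟨h.same.trans (.setNat (by grind) _ _), hmarked ▸ h.marked, hmarked ▸ h.valid⟩

theorem exists_halts_roundProgram (R : Conflict d) : ∃ T, PolyBounded T ∧
    ∀ {n k V i r : ℕ} {c : Fin n → EuclideanSpace ℝ (Fin d)} {A : Set (Fact ℕ d)}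
      {s s' : Memory}, Prepared c k V s →
      (∀ φ ∈ A, ∃ f, 1 ≤ f ∧ f < V ∧ (tablesOf d s).read f = φ) →
      MarkInv R n V A s i s' → s'.nat roundVar 0 = r →
        HaltsWithin (roundProgram R) s' (T V) fun u =>
          MarkInv R n V A s (i + 1) u ∧ u.nat roundVar 0 = r - 1 := by
  obtain ⟨T, hT, hmark⟩ := exists_halts_markProgram R
  refine ⟨_, .add (.const _) <| .add (hT.loop (.not (.natEq (.var factVar) (.lit 0)))) (.const _),
    fun {n k V i r c A s s'} hs hA h hr => .seq_of_eq (.natStore rfl) <| .seq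
    (.loop (I := fun f₀ => SweepInv R n V A s i r f₀) (Q := SweepInv R n V A s i r 0) (m := V)
      ?_ ?_ ⟨h.setNat (by simp) _ _, ?_, ?_, le_rfl, by omega⟩)
    fun u hu => .natStore ⟨hu.markInv_succ.setNat (by simp) _ _, ?_⟩⟩
  · intro f₀ u hu hdone
    obtain rfl : f₀ = 0 := by simpa [Test.Holds, NExpr.eval, hu.fact] using hdone
    exact hu
  · intro f₀ u hu hnot_done
    have hf₀ : f₀ ≠ 0 := by simpa [Test.Holds, NExpr.eval, hu.fact] using hnot_done
    have hbound : u.nat boundVar 0 = V := by rw [hu.same.nat boundVar (by simp), hs.bound]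
    have htail : u.nat tailArray = s.nat tailArray := hu.same.nat tailArray (by simp)
    refine (hmark (htail ▸ fun v => hs.tail_lt) (htail ▸ hs.tail_zero) ?_).mono (by rw [hbound])
      fun u' hstep => ⟨f₀ - 1, by omega, hu.step hs hA hf₀ hstep⟩
    rw [hu.fact, hbound]
    exact hu.fact_le
  · simpa [Memory.setNat_nat] using hr
  · simp [NExpr.eval, Memory.setNat_nat, h.same.nat boundVar, hs.bound]
  · simp [NExpr.eval, Memory.setNat_nat, hu.round]

theorem exists_halts_roundsProgram (R : Conflict d) : ∃ T, PolyBounded T ∧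
    ∀ {n k V : ℕ} {c : Fin n → EuclideanSpace ℝ (Fin d)} {A : Set (Fact ℕ d)} {s : Memory},
      Prepared c k V s → k ≤ V →
      (∀ φ ∈ A, ∃ f, 1 ≤ f ∧ f < V ∧ (tablesOf d s).read f = φ) →
        HaltsWithin (roundsProgram R) s (T V) (MarkInv R n V A s k) := by
  obtain ⟨T, hT, hround⟩ := exists_halts_roundProgram R
  refine ⟨_, .add (.const _) (hT.loop (.not (.natEq (.var roundVar) (.lit 0)))),
    fun {n k V c A s} hs hkV hA => .seq_of_eq (.natStore rfl) <|
    (HaltsWithin.loop (Q := MarkInv R n V A s k) (m := k)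
      (I := fun r u => ∃ i, i + r = k ∧ MarkInv R n V A s i u ∧ u.nat roundVar 0 = r)
      ?_ ?_ ⟨0, k.zero_add, .setNat ⟨.refl s, ?_, ?_⟩ (by simp) _ _, ?_⟩).mono
        (by gcongr) fun _ h => h⟩
  · rintro r u ⟨i, rfl, hu, hr⟩ hdone
    obtain rfl : r = 0 := by simpa [Test.Holds, NExpr.eval, hr] using hdone
    exact hu
  · rintro r u ⟨i, hi, hu, hr⟩ hnot_done
    have hr₀ : r ≠ 0 := by simpa [Test.Holds, NExpr.eval, hr] using hnot_done
    exact (hround hs hA hu hr).mono le_rfl fun u' hu' =>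
      ⟨r - 1, by omega, i + 1, by omega, hu'⟩
  · exact fun f _ _ hder => nomatch hder
  · exact fun f hf => absurd hf.2.2 (by simp [hs.unmarked])
  · simpa [Memory.setNat_nat, NExpr.eval] using hs.count

end Marking

end Packing

/-! ### The algorithm -/

namespace Packing

open RealRAM

section Algorithm

variable {d n k V : ℕ} {R : Conflict d} {s s' : Memory}
  {B : EuclideanSpace ℝ (Fin d) → Set (EuclideanSpace ℝ (Fin d))}
  {c : Fin n → EuclideanSpace ℝ (Fin d)}

/-- Centres are in conflict if and only if the bodies `B` around them intersect. -/
def Conflict.Describes (R : Conflict d)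
    (B : EuclideanSpace ℝ (Fin d) → Set (EuclideanSpace ℝ (Fin d))) : Prop :=
  ∀ x y, Disjoint (B x) (B y) ↔ ¬ R.rel x y

theorem Conflict.Describes.hasPacking_iff (hR : R.Describes B) {x : ℕ → Fin d → ℝ}
    (hx : ∀ p : Fin n, x p = c p) :
    HasPacking B c k ↔ ∃ S ⊆ Finset.range n, S.card = k ∧ IsPacking x R.rel S := by
  constructor
  · rintro ⟨S, hcard, hdisj⟩
    refine ⟨S.map Fin.valEmbedding, fun p hp => ?_, by rw [Finset.card_map, hcard], ?_⟩
    · obtain ⟨i, -, rfl⟩ := Finset.mem_map.1 hp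
      exact Finset.mem_range.2 i.2
    · rw [IsPacking, Finset.coe_map, Fin.valEmbedding.injective.injOn.pairwise_image]
      intro i hi j hj hij
      simpa only [Function.onFun, Fin.valEmbedding_apply, hx] using (hR _ _).1 (hdisj hi hj hij)
  · rintro ⟨S, hS, hcard, hpack⟩
    have hlt : ∀ p ∈ S, p < n := fun p hp => Finset.mem_range.1 (hS hp)
    refine ⟨S.attachFin hlt, by rw [Finset.card_attachFin, hcard], fun i hi j hj hij => ?_⟩
    rw [Function.onFun, hR, ← hx, ← hx]
    exact hpack (Finset.mem_attachFin hlt |>.1 hi) (Finset.mem_attachFin hlt |>.1 hj)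
      (Fin.val_injective.ne hij)

/-- The constant in the length of the lists of points that suffices for conflicts of resolution
`r`. -/
def lengthConst (d r : ℕ) : ℕ := 2 * d * cutConst d r

theorem listLength_pos (hd : 0 < d) (hk : 0 < k) {r : ℕ} :
    0 < listLength d (lengthConst d r) k := by
  have : 0 < lengthConst d r := by unfold lengthConst cutConst; positivity
  exact Nat.ceil_pos.2 (by positivity)

/-- The number of table entries needed to decide whether there are `k` pairwise nonintersecting
bodies among `n`; the cases in which that is obvious do not need any. -/
noncomputable def tableSize (d r n k : ℕ) : ℕ :=
  if 0 < k ∧ k ≤ n then (n + 3) ^ (4 * d + 1 + listLength d (lengthConst d r) k) else 0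

theorem le_tableSize {r : ℕ} (hk : 0 < k) (hkn : k ≤ n) : k ≤ tableSize d r n k := by
  rw [tableSize, if_pos ⟨hk, hkn⟩]
  exact (by omega : k ≤ n + 3).trans (Nat.le_self_pow (by omega) _)

/-- The facts that are to be derived for conflicts of resolution `r`. -/
abbrev listedFacts (d r n k : ℕ) (x : ℕ → Fin d → ℝ) : Set (Fact ℕ d) :=
  facts x (Finset.range n) (listLength d (lengthConst d r) k)

theorem Prepared.exists_read_eq (hk : 0 < k) (hkn : k ≤ n) {r : ℕ}
    (hs : Prepared c k (tableSize d r n k) s) :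
    ∀ φ ∈ listedFacts d r n k (tablesOf d s).point,
      ∃ f, 1 ≤ f ∧ f < tableSize d r n k ∧ (tablesOf d s).read f = φ := by
  have hencodes := hs.encodes
  rw [tableSize, if_pos ⟨hk, hkn⟩] at hencodes ⊢
  exact fun φ hφ => hencodes.exists_read_eq hφ

theorem Prepared.exists_derivable (hd : 0 < d) (hk : 0 < k) (hkn : k ≤ n)
    (hs : Prepared c k (tableSize d R.resolution n k) s) {S : Finset ℕ} (hS : S ⊆ Finset.range n)
    (hcard : S.card = k) (hpack : IsPacking (tablesOf d s).point R.rel S) :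
    ∃ f, 1 ≤ f ∧ f < tableSize d R.resolution n k ∧ ((tablesOf d s).read f).count = k ∧
      ((tablesOf d s).read f).Derivable (tablesOf d s).point (Finset.range n) R.rel
        (listedFacts d R.resolution n k (tablesOf d s).point) k := by
  subst hcard
  obtain ⟨φ, hcount, hφ⟩ := Fact.exists_derivable_of_isPacking R.of_close
    (listLength_pos (r := R.resolution) hd hk)
    (le_trans (by simp [lengthConst, mul_assoc]) (Nat.le_ceil _)) (Finset.card_pos.1 hk) hS hpack
  obtain ⟨f, hf, hfV, rfl⟩ := hs.exists_read_eq hk hkn φ hφ.mem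
  exact ⟨f, hf, hfV, hcount, hφ⟩

theorem MarkInv.holds_answerFormula_iff (hd : 0 < d) (hk : 0 < k) (hkn : k ≤ n)
    (hR : R.Describes B) (hs : Prepared c k (tableSize d R.resolution n k) s)
    (h : MarkInv R n (tableSize d R.resolution n k)
      (listedFacts d R.resolution n k (tablesOf d s).point) s k s') :
    answerFormula.Holds 8 s' ↔ HasPacking B c k := by
  rw [holds_answerFormula s' d, h.same.tablesOf_eq, h.same.nat boundVar (by simp),
    h.same.nat inputArray (by simp), hs.bound, hs.count, hR.hasPacking_iff hs.point]
  constructor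
  · rintro ⟨f, hf, hcount⟩
    obtain ⟨P, hP⟩ := h.valid f hf
    exact ⟨P, hP.subset, hP.card_eq.trans hcount, hP.isPacking⟩
  · rintro ⟨S, hS, hcard, hpack⟩
    obtain ⟨f, hf, hfV, hcount, hder⟩ := hs.exists_derivable hd hk hkn hS hcard hpack
    exact ⟨f, h.marked f hf hfV.le hder, hcount⟩

/-- The output of the memory `s` is the answer to the question whether there are `k` pairwise
nonintersecting bodies. -/
def IsAnswer (B : EuclideanSpace ℝ (Fin d) → Set (EuclideanSpace ℝ (Fin d)))
    (c : Fin n → EuclideanSpace ℝ (Fin d)) (k : ℕ) (s : Memory) : Prop :=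
  (HasPacking B c k → output s = 1) ∧ (¬ HasPacking B c k → output s = 0)

/-- Decides about the existence of `k` pairwise nonintersecting bodies if `0 < k ≤ n`. -/
def solveProgram (R : Conflict d) : Program :=
  .seq (prepareProgram d (lengthConst d R.resolution)) <| .seq (roundsProgram R) <|
    .seq (answerFormula.compile 8) (.assignNat 0 (.var resultReg))

theorem exists_halts_solveProgram (hd : 0 < d) (hR : R.Describes B) : ∃ T, PolyBounded T ∧
    ∀ {n k : ℕ} (c : Fin n → EuclideanSpace ℝ (Fin d)), 0 < k → k ≤ n →
      HaltsWithin (solveProgram R) (input c k) (T (tableSize d R.resolution n k))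
        (IsAnswer B c k) := by
  obtain ⟨T₁, hT₁, hprepare⟩ := exists_halts_prepareProgram hd (lengthConst d R.resolution)
  obtain ⟨T₂, hT₂, hrounds⟩ := exists_halts_roundsProgram R
  refine ⟨_, .add hT₁ <| .add hT₂ <| .add answerFormula.polyBounded_costBound (.const _),
    fun {n k} c hk hkn => .seq (hprepare c hkn (if_pos ⟨hk, hkn⟩)) fun s hs => .seq
      (hrounds hs (le_tableSize hk hkn) (hs.exists_read_eq hk hkn)) fun u hu => .seq
      (Formula.evaluatedBy_compile (by norm_num) below_answerFormula ?_ ?_ u (.refl 8 u))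
      fun u' ⟨_, hreports⟩ => .natStore ?_⟩
  · rw [hu.same.nat tailArray (by simp)]
    exact fun v => hs.tail_lt
  · rw [← hs.bound, ← hu.same.nat boundVar (by simp)]
    exact bounded_answerFormula u
  · rw [hu.holds_answerFormula_iff hd hk hkn hR hs] at hreports
    exact ⟨fun h => by simp [output, Memory.setNat_nat, NExpr.eval, hreports.1 h],
      fun h => by simp [output, Memory.setNat_nat, NExpr.eval, hreports.2 h]⟩

/-- Decides about the existence of `k` pairwise nonintersecting bodies. -/
def packingProgram (R : Conflict d) : Program :=
  .branch (.natEq (.load inputArray (.lit 1)) (.lit 0)) (.assignNat 0 (.lit 1)) <|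
    .branch (.natLE (.load inputArray (.lit 1)) (.load inputArray (.lit 0))) (solveProgram R)
      (.assignNat 0 (.lit 0))

theorem hasPacking_zero : HasPacking B c 0 := ⟨∅, rfl, by simp⟩

theorem HasPacking.le (h : HasPacking B c k) : k ≤ n := by
  obtain ⟨S, rfl, -⟩ := h
  exact S.card_le_univ.trans_eq (Fintype.card_fin n)

theorem exists_halts_packingProgram (hd : 0 < d) (hR : R.Describes B) : ∃ T, PolyBounded T ∧
    ∀ {n : ℕ} (k : ℕ) (c : Fin n → EuclideanSpace ℝ (Fin d)),
      HaltsWithin (packingProgram R) (input c k) (T (tableSize d R.resolution n k))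
        (IsAnswer B c k) := by
  obtain ⟨T, hT, hsolve⟩ := exists_halts_solveProgram hd hR
  refine ⟨_, .add (.add (.const _) <| .add (.add (.const _) <| .add hT (.const 3)) (.const 1))
    (.const 1), fun {n} k c => .branch (fun hzero => ?_) fun hpos => .branch (fun hle => ?_)
      fun hgt => ?_⟩
  · obtain rfl : k = 0 := by simpa [Test.Holds, NExpr.eval, input] using hzero
    exact (HaltsWithin.natStore ⟨fun _ => by simp [output, Memory.setNat_nat, NExpr.eval],
      fun h => absurd hasPacking_zero h⟩).mono (by simp only [NExpr.cost]; omega) fun _ h => h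
  · refine (hsolve c (Nat.pos_of_ne_zero ?_) ?_).mono (Nat.le_add_right _ _) fun _ h => h
    · simpa [Test.Holds, NExpr.eval, input] using hpos
    · simpa [Test.Holds, NExpr.eval, input] using hle
  · have hnk : ¬ k ≤ n := by simpa [Test.Holds, NExpr.eval, input] using hgt
    exact (HaltsWithin.natStore ⟨fun h => absurd h.le hnk,
      fun _ => by simp [output, Memory.setNat_nat, NExpr.eval]⟩).mono
        (by simp only [NExpr.cost]; omega) fun _ h => h

end Algorithm

/-! ### The running time -/

section RunningTime

variable {d n k : ℕ}

theorem succ_pow_le_eight_mul_pow {W : ℕ} (hn : 1 ≤ n) (hW : 1 ≤ W) :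
    (n + 3) ^ W + 1 ≤ (8 * n) ^ W := by
  have hone : 1 ≤ (n + 3) ^ W := Nat.one_le_pow _ _ (by omega)
  have htwo : 2 ≤ 2 ^ W := Nat.le_self_pow (by omega) 2
  calc (n + 3) ^ W + 1 ≤ 2 ^ W * (n + 3) ^ W := by nlinarith
    _ = (2 * (n + 3)) ^ W := (mul_pow _ _ _).symm
    _ ≤ (8 * n) ^ W := Nat.pow_le_pow_left (by omega) W

theorem one_le_rpow_one_sub_inv (hd : 0 < d) (hk : 0 < k) :
    1 ≤ (k : ℝ) ^ (1 - 1 / (d : ℝ)) := by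
  refine Real.one_le_rpow (by exact_mod_cast hk) (sub_nonneg.2 ?_)
  exact (div_le_one (by positivity)).2 (by exact_mod_cast hd)

theorem length_le_mul_rpow (hd : 0 < d) (hk : 0 < k) (L : ℕ) :
    ((4 * d + 1 + listLength d L k : ℕ) : ℝ) ≤
      (4 * d + 2 + L : ℕ) * (k : ℝ) ^ (1 - 1 / (d : ℝ)) := by
  have hK := one_le_rpow_one_sub_inv hd hk
  have hlength : (listLength d L k : ℝ) < L * (k : ℝ) ^ (1 - 1 / (d : ℝ)) + 1 :=
    Nat.ceil_lt_add_one (by positivity)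
  push_cast
  nlinarith [d.cast_nonneg (α := ℝ)]

theorem eight_rpow_le (hk : 0 < k) (hkn : k ≤ n) {K w : ℝ} (hK : K = k ^ (1 - 1 / (d : ℝ)))
    (hw : 0 ≤ w) : (8 : ℝ) ^ (w * K) ≤ 8 ^ w * (n : ℝ) ^ (3 * (w * K)) := by
  have hn : (1 : ℝ) ≤ n := by exact_mod_cast (by omega : 1 ≤ n)
  have hK0 : 0 ≤ K := hK ▸ by positivity
  obtain rfl | htwo := (by omega : n = 1 ∨ 2 ≤ n)
  · obtain rfl : k = 1 := by omega
    simp [hK]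
  · have height : (8 : ℝ) ≤ (n : ℝ) ^ (3 : ℝ) := by
      have : (2 : ℝ) ^ 3 ≤ (n : ℝ) ^ 3 := by gcongr; exact_mod_cast htwo
      rw [Real.rpow_ofNat]
      linarith
    calc (8 : ℝ) ^ (w * K) ≤ ((n : ℝ) ^ (3 : ℝ)) ^ (w * K) := by gcongr
      _ = (n : ℝ) ^ (3 * (w * K)) := (Real.rpow_mul (by positivity) _ _).symm
      _ ≤ 8 ^ w * (n : ℝ) ^ (3 * (w * K)) :=
        le_mul_of_one_le_left (by positivity) (Real.one_le_rpow (by norm_num) hw)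

theorem exists_tableSize_le (hd : 0 < d) (r : ℕ) : ∃ w : ℝ, 0 ≤ w ∧ ∀ n k : ℕ,
    (tableSize d r n k : ℝ) + 1 ≤
      8 ^ w * ((max n 1 : ℕ) : ℝ) ^ (4 * w * (k : ℝ) ^ (1 - 1 / (d : ℝ))) := by
  set w : ℕ := 4 * d + 2 + lengthConst d r
  refine ⟨w, by positivity, fun n k => ?_⟩
  set K : ℝ := (k : ℝ) ^ (1 - 1 / (d : ℝ)) with hK
  unfold tableSize
  split_ifs with h
  · obtain ⟨hk, hkn⟩ := h
    have hn : (1 : ℝ) ≤ n := by exact_mod_cast hk.trans_le hkn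
    rw [max_eq_left (hk.trans_le hkn)]
    set W := 4 * d + 1 + listLength d (lengthConst d r) k
    calc (((n + 3) ^ W : ℕ) : ℝ) + 1 ≤ (8 * n : ℝ) ^ (W : ℝ) := by
          rw [Real.rpow_natCast]
          exact_mod_cast succ_pow_le_eight_mul_pow (hk.trans_le hkn) (by omega : 1 ≤ W)
      _ ≤ (8 * n : ℝ) ^ (w * K) :=
        Real.rpow_le_rpow_of_exponent_le (by linarith) (length_le_mul_rpow hd hk _)
      _ = 8 ^ (w * K) * (n : ℝ) ^ (w * K) := Real.mul_rpow (by norm_num) (by linarith)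
      _ ≤ 8 ^ (w : ℝ) * (n : ℝ) ^ (3 * (w * K)) * (n : ℝ) ^ (w * K) := by
        gcongr
        exact eight_rpow_le hk hkn hK w.cast_nonneg
      _ = 8 ^ (w : ℝ) * (n : ℝ) ^ (4 * w * K) := by
        rw [mul_assoc, ← Real.rpow_add (by linarith)]
        ring_nf
  · have hmax : (1 : ℝ) ≤ ((max n 1 : ℕ) : ℝ) := by exact_mod_cast le_max_right n 1
    rw [Nat.cast_zero, zero_add]
    exact one_le_mul_of_one_le_of_one_le (Real.one_le_rpow (by norm_num) w.cast_nonneg)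
      (Real.one_le_rpow hmax (by positivity))

theorem exists_rpow_bound_of_polyBounded {T : ℕ → ℕ} (hT : PolyBounded T) (hd : 0 < d) (r : ℕ) :
    ∃ C : ℝ, ∀ n k : ℕ, (T (tableSize d r n k) : ℝ) ≤
      C * ((max n 1 : ℕ) : ℝ) ^ (C * (k : ℝ) ^ (1 - 1 / (d : ℝ))) := by
  obtain ⟨A, m, hA⟩ := hT
  obtain ⟨w, hw, hsize⟩ := exists_tableSize_le hd r
  refine ⟨A * (8 ^ w) ^ m + 4 * w * m, fun n k => ?_⟩
  set N : ℝ := ((max n 1 : ℕ) : ℝ)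
  have hN : 1 ≤ N := Nat.one_le_cast.2 (le_max_right n 1)
  set K : ℝ := (k : ℝ) ^ (1 - 1 / (d : ℝ))
  calc (T (tableSize d r n k) : ℝ) ≤ A * ((tableSize d r n k : ℝ) + 1) ^ m := by
        exact_mod_cast hA _
    _ ≤ A * (8 ^ w * N ^ (4 * w * K)) ^ m := by
      gcongr
      exact hsize n k
    _ = A * (8 ^ w) ^ m * N ^ (4 * w * m * K) := by
      rw [mul_right_comm (4 * w), Real.rpow_mul_natCast (zero_le_one.trans hN), mul_pow]
      ring
    _ ≤ (A * (8 ^ w) ^ m + 4 * w * m) * N ^ ((A * (8 ^ w) ^ m + 4 * w * m) * K) := by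
      gcongr
      exacts [le_add_of_nonneg_right (by positivity), le_add_of_nonneg_left (by positivity)]

end RunningTime

end Packing

/-! ### Balls and cubes -/

namespace RealRAM

section Sum

variable {D m : ℕ} {s : Memory} {f : Fin m → RExpr}

/-- The sum of finitely many expressions. -/
def RExpr.sum {m : ℕ} (f : Fin m → RExpr) : RExpr := (List.ofFn f).foldr .add (.lit 0)

theorem RExpr.sum_eval : (RExpr.sum f).eval s = ∑ j, (f j).eval s := by
  rw [sum, ← List.sum_ofFn, ← Function.comp_def (eval s) f, ← List.map_ofFn]
  induction List.ofFn f with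
  | nil => simp [eval]
  | cons e l ih => simp [eval, ih]

theorem RExpr.below_sum : (RExpr.sum f).Below D ↔ ∀ j, (f j).Below D := by
  rw [sum, ← List.forall_mem_ofFn_iff]
  induction List.ofFn f with
  | nil => simp [Below]
  | cons e l ih => simp [Below, ih]

end Sum

/-- The test for `e < f` if `strict` is true, and for `e ≤ f` otherwise. -/
def Test.realLess (strict : Bool) (e f : RExpr) : Test :=
  if strict then .realLT e f else .realLE e f

end RealRAM

namespace Packing

open RealRAM

variable {d : ℕ} {strict : Bool} {a b : ℝ}

/-- `a < b` if `strict` is true, and `a ≤ b` otherwise: it tells open from closed bodies. -/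
def Less (strict : Bool) (a b : ℝ) : Prop := if strict then a < b else a ≤ b

theorem Less.le (h : Less strict a b) : a ≤ b := by
  cases strict
  exacts [h, LT.lt.le h]

theorem Less.of_lt (h : a < b) : Less strict a b := by
  cases strict
  exacts [h.le, h]

theorem less_abs_iff : Less strict |a| b ↔ Less strict a b ∧ Less strict (-a) b := by
  cases strict
  exacts [abs_le', max_lt_iff]

theorem less_pow_iff (ha : 0 ≤ a) (hb : 0 ≤ b) : Less strict (a ^ 2) (b ^ 2) ↔ Less strict a b := by
  cases strict
  exacts [sq_le_sq₀ ha hb, sq_lt_sq₀ ha hb]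

theorem holds_realLess {s : Memory} {e f : RExpr} :
    (Test.realLess strict e f).Holds s ↔ Less strict (e.eval s) (f.eval s) := by
  cases strict <;> rfl

theorem below_realLess {D : ℕ} {e f : RExpr} :
    (Test.realLess strict e f).Below D ↔ e.Below D ∧ f.Below D := by
  cases strict <;> rfl

theorem exists_less_abs_sub_iff {r : ℝ} :
    (∃ z, Less strict |z - a| r ∧ Less strict |z - b| r) ↔ Less strict |a - b| (2 * r) := by
  constructor
  · rintro ⟨z, ha, hb⟩
    have htriangle := abs_sub_le a z b
    rw [abs_sub_comm a z] at htriangle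
    cases strict
    exacts [htriangle.trans (by linarith [ha.le, hb.le]),
      htriangle.trans_lt (by simp only [Less, if_true] at ha hb; linarith)]
  · refine fun h => ⟨(a + b) / 2, ?_⟩
    rw [show (a + b) / 2 - a = -((a - b) / 2) by ring, show (a + b) / 2 - b = (a - b) / 2 by ring,
      abs_neg, and_self, abs_div, abs_two]
    cases strict
    exacts [(div_le_iff₀' two_pos).2 h, (div_lt_iff₀' two_pos).2 h]

/-- Two unit balls intersect. -/
def ballConflict (d : ℕ) (strict : Bool) : Conflict d where
  rel y z := Less strict (∑ j, (y j - z j) ^ 2) (2 ^ 2)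
  test e f := .realLess strict (.sum fun j : Fin d => .pow (.sub (.load j e) (.load j f)) 2)
    (.lit (2 ^ 2))
  resolution := d
  holds_test s e f := by
    simp [holds_realLess, RExpr.sum_eval, RExpr.pow_eval, RExpr.eval]
  below_test D e f he hf := by
    simp [below_realLess, RExpr.below_sum, RExpr.pow, RExpr.Below, he, hf]
  symm y z h := by simpa only [fun j => sub_sq_comm (z j) (y j)] using h
  close y z h j := by
    refine abs_le_of_sq_le_sq (le_trans ?_ h.le) two_pos.le
    exact Finset.single_le_sum (f := fun j => (y j - z j) ^ 2) (fun _ _ => sq_nonneg _)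
      (Finset.mem_univ j)
  of_close y z h := by
    refine .of_lt (lt_of_le_of_lt ?_ (by norm_num : (1 : ℝ) < 2 ^ 2))
    calc ∑ j, (y j - z j) ^ 2 ≤ ∑ _j : Fin d, (d : ℝ)⁻¹ := Finset.sum_le_sum fun j _ => ?_
      _ = d * (d : ℝ)⁻¹ := by simp
      _ ≤ 1 := mul_inv_le_one
    have hd : (1 : ℝ) ≤ d := by exact_mod_cast j.pos
    have hle : |y j - z j| ≤ (d : ℝ)⁻¹ :=
      (le_inv_mul_iff₀ (by linarith)).2 (h j) |>.trans_eq (mul_one _)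
    rw [← sq_abs]
    nlinarith [abs_nonneg (y j - z j), inv_le_one_of_one_le₀ hd]

/-- Two axis-parallel cubes of side length `1` intersect. -/
def cubeConflict (d : ℕ) (strict : Bool) : Conflict d where
  rel y z := ∀ j, Less strict |y j - z j| 1
  test e f := .all fun j : Fin d =>
    .and (.realLess strict (.sub (.load j e) (.load j f)) (.lit 1))
      (.realLess strict (.sub (.load j f) (.load j e)) (.lit 1))
  resolution := 2
  holds_test s e f := by
    simp [Test.Holds, holds_realLess, RExpr.eval, less_abs_iff]
  below_test D e f he hf := by
    simp [Test.Below, below_realLess, RExpr.Below, he, hf]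
  symm y z h j := abs_sub_comm (y j) (z j) ▸ h j
  close y z h j := (h j).le.trans one_le_two
  of_close y z h j := .of_lt (by have := h j; push_cast at this; linarith)

theorem ballConflict_rel_iff {x y : EuclideanSpace ℝ (Fin d)} :
    (ballConflict d strict).rel x y ↔ Less strict (dist x y) 2 := by
  rw [← less_pow_iff dist_nonneg two_pos.le, EuclideanSpace.dist_sq_eq]
  simp only [Real.dist_eq, sq_abs]
  rfl

theorem describes_ball : (ballConflict d true).Describes fun x => Metric.ball x 1 := by
  intro x y
  rw [disjoint_ball_ball_iff one_pos one_pos, ballConflict_rel_iff, Less, if_pos rfl, not_lt,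
    one_add_one_eq_two]

theorem describes_closedBall :
    (ballConflict d false).Describes fun x => Metric.closedBall x 1 := by
  intro x y
  rw [disjoint_closedBall_closedBall_iff zero_le_one zero_le_one, ballConflict_rel_iff, Less,
    if_neg Bool.false_ne_true, not_le, one_add_one_eq_two]

theorem describes_cube (d : ℕ) (strict : Bool) :
    (cubeConflict d strict).Describes fun x => {z | ∀ j, Less strict |z j - x j| (1 / 2)} := by
  intro x y
  have hmidpoint (j : Fin d) := exists_less_abs_sub_iff (strict := strict) (a := x j) (b := y j)
    (r := 1 / 2)
  rw [← not_iff_not, not_not, Set.not_disjoint_iff]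
  constructor
  · rintro ⟨z, hx, hy⟩ j
    simpa using (hmidpoint j).1 ⟨z j, hx j, hy j⟩
  · intro h
    choose z hz using fun j => (hmidpoint j).2 (by simpa using h j)
    exact ⟨WithLp.toLp 2 z, fun j => (hz j).1, fun j => (hz j).2⟩

theorem exists_conflict_describes {B : EuclideanSpace ℝ (Fin d) → Set (EuclideanSpace ℝ (Fin d))}
    (hB : (B = fun x => Metric.ball x 1) ∨ (B = fun x => Metric.closedBall x 1) ∨
      B = openCube ∨ B = closedCube) : ∃ R : Conflict d, R.Describes B := by
  rcases hB with rfl | rfl | rfl | rfl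
  exacts [⟨_, describes_ball⟩, ⟨_, describes_closedBall⟩, ⟨_, describes_cube d true⟩,
    ⟨_, describes_cube d false⟩]

end Packing

theorem mainTheorem8_general {d : ℕ} (hd : 0 < d) {R : Packing.Conflict d}
    {B : EuclideanSpace ℝ (Fin d) → Set (EuclideanSpace ℝ (Fin d))} (hR : R.Describes B) :
    ∃ (P : RealRAM.Program) (C : ℝ),
      ∀ (n k : ℕ) (c : Fin n → EuclideanSpace ℝ (Fin d)),
        ∃ (s : RealRAM.Memory) (t : ℕ),
          RealRAM.Runs P (Packing.input c k) s t ∧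
          (Packing.HasPacking B c k → Packing.output s = 1) ∧
          (¬ Packing.HasPacking B c k → Packing.output s = 0) ∧
          (t : ℝ) ≤ C * ((max n 1 : ℕ) : ℝ) ^ (C * (k : ℝ) ^ (1 - 1 / (d : ℝ))) := by
  obtain ⟨T, hT, hhalts⟩ := Packing.exists_halts_packingProgram hd hR
  obtain ⟨C, hC⟩ := Packing.exists_rpow_bound_of_polyBounded hT hd R.resolution
  refine ⟨Packing.packingProgram R, C, fun n k c => ?_⟩
  obtain ⟨s, t, hrun, ht, hyes, hno⟩ := hhalts k c
  exact ⟨s, t, hrun, hyes, hno, (Nat.cast_le.2 ht).trans (hC n k)⟩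

theorem mainTheorem8 (d : ℕ) (hd : 2 ≤ d)
    (B : EuclideanSpace ℝ (Fin d) → Set (EuclideanSpace ℝ (Fin d)))
    (hB : (B = fun x => Metric.ball x 1) ∨ (B = fun x => Metric.closedBall x 1) ∨
      B = Packing.openCube ∨ B = Packing.closedCube) :
    ∃ (P : RealRAM.Program) (C : ℝ),
      ∀ (n k : ℕ) (c : Fin n → EuclideanSpace ℝ (Fin d)),
        ∃ (s : RealRAM.Memory) (t : ℕ),
          RealRAM.Runs P (Packing.input c k) s t ∧
          (Packing.HasPacking B c k → Packing.output s = 1) ∧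
          (¬ Packing.HasPacking B c k → Packing.output s = 0) ∧
          (t : ℝ) ≤ C * ((max n 1 : ℕ) : ℝ) ^ (C * (k : ℝ) ^ (1 - 1 / (d : ℝ))) := by
  obtain ⟨R, hR⟩ := Packing.exists_conflict_describes hB
  exact mainTheorem8_general (by omega) hR
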